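/- **Setting.** Let $\mathcal C$ be a set of $m$ candidates and $\mathcal V$ a set of $n\ge 1$ voters; each voter $v$ reports a linear order $\succ_v$ on $\mathcal C$. A scoring rule $r$ is given by a vector $\alpha=(\alpha_1,\dots,\alpha_m)\in\mathbb Q^m$ with $\alpha_1\ge\alpha_2\ge\dots\ge\alpha_m$ and $\alpha_1>\alpha_m$, and a linear order $\succ_t$ on $\mathcal C$: a candidate gets $\alpha_i$ points from every vote that places it at position $i$, and $r$ returns, among the candidates with maximum total score, the one that is first in $\succ_t$. For a profile $(\succ_v)_{v\in\mathcal V}$ with winner $x=r((\succ_v)_{v\in\mathcal V})$ and a candidate $y$, a set $M\subseteq\mathcal V$ is a *coalition of possible manipulators against $y$* if $y\ne x$ and there are linear orders $(\succ'_j)_{j\in M}$ with $x\succ'_j y$ for all $j\in M$ and $r\big((\succ_v)_{v\in\mathcal V\setminus M},(\succ'_j)_{j\in M}\big)=y$. It is a *coalition of possible manipulators* if it is one against some candidate $y$. Consider the following decision problems, in which the rule $(\alpha,\succ_t)$ and the profile $(\succ_v)_{v\in\mathcal V}$ are part of the input. * **CPMW**: given also $M\subseteq\mathcal V$ and $y\in\mathcal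 C$, is $M$ a coalition of possible manipulators against $y$? * **CPM**: given also $M\subseteq\mathcal V$, is $M$ a coalition of possible manipulators? * **CPMSW**: given also $y\in\mathcal C$ and an integer $k$, is there $M\subseteq\mathcal V$ with $|M|\le k$ that is a coalition of possible manipulators against $y$? * **CPMS**: given also an integer $k$, is there $M\subseteq\mathcal V$ with $|M|\le k$ that is a coalition of possible manipulators? The entries of $\alpha$ are written as integers over their least common denominator; all numbers and candidate names are written in binary, a linear order as the list of the candidates from first to last, and $M$ as its characteristic vector. **Theorem.** CPMW and CPM restricted to instances with $|M|=1$, and CPMSW and CPMS restricted to instances with $k=1$, can be decided in polynomial time: for each of the four problems there are a Turing machine and a polynomial $p$ such that on every instance, encoded by a string of length $\ell$, the machine halts with the correct answer after at most $p(\ell)$ steps. -/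

import Mathlib

namespace PossibleManipulators

/-! ### Elections -/

/-- A preference (linear order) over the `m` candidates, given as the bijection that sends a
candidate to its position; position `0` is the top position. -/
abbrev Preference (m : ℕ) : Type := Equiv.Perm (Fin m)

/-- Candidate `a` is weakly preferred to candidate `b`. -/
def Preference.Prefers {m : ℕ} (p : Preference m) (a b : Fin m) : Prop := p a ≤ p b

/-- The preferences of `n` voters over `m` candidates. -/
abbrev Profile (m n : ℕ) : Type := Fin n → Preference m

/-- A (resolute) voting rule for `n` voters and `m` candidates. -/
abbrev VotingRule (m n : ℕ) : Type := Profile m n → Fin m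

/-- The score of candidate `c`: the vote of `v` contributes the entry of the scoring vector `α`
at the position of `c` in that vote. -/
def score {m n : ℕ} (α : Fin m → ℚ) (P : Profile m n) (c : Fin m) : ℚ :=
  ∑ v, α (P v c)

/-- The candidates of maximum score. -/
def coWinners {m n : ℕ} (α : Fin m → ℚ) (P : Profile m n) : Finset (Fin m) :=
  Finset.univ.filter fun c => ∀ d, score α P d ≤ score α P c

theorem coWinners_nonempty {m n : ℕ} (hm : 0 < m) (α : Fin m → ℚ) (P : Profile m n) :
    (coWinners α P).Nonempty := by
  obtain ⟨c, -, hc⟩ := Finset.exists_max_image Finset.univ (score α P) ⟨⟨0, hm⟩, Finset.mem_univ _⟩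
  exact ⟨c, by simpa [coWinners] using hc⟩

/-- Lexicographic tie-breaking: the element of `S` that comes first in the preference `t`. -/
def tieBreak {m : ℕ} (t : Preference m) (S : Finset (Fin m)) (hS : S.Nonempty) : Fin m :=
  t.symm ((S.image t).min' (hS.image t))

/-- The positional scoring rule with scoring vector `α` and lexicographic tie-breaking
according to `t`. -/
def scoringRule {m : ℕ} (hm : 0 < m) (α : Fin m → ℚ) (t : Preference m) (n : ℕ) :
    VotingRule m n :=
  fun P => tieBreak t (coWinners α P) (coWinners_nonempty hm α P)

/-! ### Coalitions of possible manipulators -/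

/-- The profile in which the voters in `M` vote according to `Q` and all others according
to `P`. -/
def replaceVotes {m n : ℕ} (P : Profile m n) (M : Finset (Fin n)) (Q : M → Preference m) :
    Profile m n :=
  fun v => if h : v ∈ M then Q ⟨v, h⟩ else P v

/-- `M` is a coalition of possible manipulators against `y`; the current winner is `r P`. -/
def IsCoalitionAgainst {m n : ℕ} (r : VotingRule m n) (P : Profile m n) (M : Finset (Fin n))
    (y : Fin m) : Prop :=
  y ≠ r P ∧ ∃ Q : M → Preference m, (∀ j, (Q j).Prefers (r P) y) ∧ r (replaceVotes P M Q) = y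

/-- `M` is a coalition of possible manipulators. -/
def IsCoalition {m n : ℕ} (r : VotingRule m n) (P : Profile m n) (M : Finset (Fin n)) : Prop :=
  ∃ y, IsCoalitionAgainst r P M y

/-! ### Instances of the four problems for scoring rules -/

/-- A scoring rule (a nonincreasing, nonconstant scoring vector with rational entries and a
tie-breaking order) together with a preference profile. -/
structure Election where
  /-- number of candidates -/
  m : ℕ
  /-- number of voters -/
  n : ℕ
  m_pos : 0 < m
  n_pos : 0 < n
  /-- scoring vector -/
  α : Fin m → ℚ
  α_antitone : Antitone α
  α_last_lt_first : α ⟨m - 1, Nat.sub_one_lt_of_lt m_pos⟩ < α ⟨0, m_pos⟩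
  /-- tie-breaking order -/
  tie : Preference m
  /-- reported votes -/
  profile : Profile m n

/-- The voting rule of an election. -/
def Election.rule (E : Election) : VotingRule E.m E.n := scoringRule E.m_pos E.α E.tie E.n

/-- Coalitional Possible Manipulators given Winner: instances. -/
structure CPMW extends Election where
  /-- suspected coalition -/
  M : Finset (Fin n)
  /-- actual winner -/
  y : Fin m

/-- Yes-instances of CPMW. -/
def CPMW.IsYes (I : CPMW) : Prop := IsCoalitionAgainst I.rule I.profile I.M I.y

/-- Coalitional Possible Manipulators: instances. -/
structure CPM extends Election where
  /-- suspected coalition -/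
  M : Finset (Fin n)

/-- Yes-instances of CPM. -/
def CPM.IsYes (I : CPM) : Prop := IsCoalition I.rule I.profile I.M

/-- Coalitional Possible Manipulators Search given Winner: instances. -/
structure CPMSW extends Election where
  /-- actual winner -/
  y : Fin m
  /-- maximum coalition size -/
  k : ℕ

/-- Yes-instances of CPMSW. -/
def CPMSW.IsYes (I : CPMSW) : Prop :=
  ∃ M : Finset (Fin I.n), M.card ≤ I.k ∧ IsCoalitionAgainst I.rule I.profile M I.y

/-- Coalitional Possible Manipulators Search: instances. -/
structure CPMS extends Election where
  /-- maximum coalition size -/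
  k : ℕ

/-- Yes-instances of CPMS. -/
def CPMS.IsYes (I : CPMS) : Prop :=
  ∃ M : Finset (Fin I.n), M.card ≤ I.k ∧ IsCoalition I.rule I.profile M

/-! ### Encoding of instances as strings -/

/-- The input alphabet: binary digits, a minus sign, an end mark for numbers and an end mark for
blocks. -/
inductive Letter where
  | bit (b : Bool)
  | minus
  | endNum
  | endBlock
  deriving DecidableEq, Fintype

/-- A natural number in binary. -/
def encNat (k : ℕ) : List Letter := (Computability.encodeNat k).map Letter.bit ++ [Letter.endNum]

/-- An integer: sign and absolute value in binary. -/
def encInt (z : ℤ) : List Letter := (if z < 0 then [Letter.minus] else []) ++ encNat z.natAbs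

/-- A preference: the list of the candidates from the top position to the bottom position. -/
def encPreference {m : ℕ} (p : Preference m) : List Letter :=
  (List.ofFn fun i => p.symm i).flatMap (fun c => encNat c) ++ [Letter.endBlock]

/-- The least common denominator of the entries of a rational vector. -/
def commonDen {m : ℕ} (α : Fin m → ℚ) : ℕ := Finset.univ.lcm fun i => (α i).den

/-- A rational vector, written over its least common denominator: the denominator, then the
numerators (the products below are integers), all in binary. -/
def encVector {m : ℕ} (α : Fin m → ℚ) : List Letter :=
  encNat (commonDen α) ++
    (List.ofFn fun i => (α i * commonDen α).num).flatMap encInt ++ [Letter.endBlock]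

/-- A set of voters: its characteristic vector. -/
def encVoters {n : ℕ} (M : Finset (Fin n)) : List Letter :=
  (List.ofFn fun v => Letter.bit (decide (v ∈ M))) ++ [Letter.endBlock]

/-- Scoring vector, tie-breaking order, and all votes. -/
def Election.encode (E : Election) : List Letter :=
  encVector E.α ++ encPreference E.tie ++
    (List.ofFn E.profile).flatMap encPreference ++ [Letter.endBlock]

/-- Encoding of CPMW instances. -/
def CPMW.encode (I : CPMW) : List Letter :=
  I.toElection.encode ++ encVoters I.M ++ encNat I.y

/-- Encoding of CPM instances. -/
def CPM.encode (I : CPM) : List Letter := I.toElection.encode ++ encVoters I.M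

/-- Encoding of CPMSW instances. -/
def CPMSW.encode (I : CPMSW) : List Letter :=
  I.toElection.encode ++ encNat I.y ++ encNat I.k

/-- Encoding of CPMS instances. -/
def CPMS.encode (I : CPMS) : List Letter := I.toElection.encode ++ encNat I.k

/-! ### Polynomial time -/

/-- The decision problem with instances `I`, encoded by `enc`, and yes-instances `Yes` is
decidable in polynomial time: some Turing machine, started on the encoding of any instance, halts
with the correct answer after a number of steps that is at most a fixed polynomial in the length
of the encoding. -/
def InP {I Γ : Type} (enc : I → List Γ) (Yes : I → Prop) : Prop :=
  ∃ f : I → Bool, (∀ a, f a = true ↔ Yes a) ∧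
    Nonempty (Turing.TM2ComputableInPolyTime enc Computability.encodeBool f)

end PossibleManipulators

namespace PossibleManipulators

/-! Fix a voter `v` and a target `y`, and name every candidate by its position in the tie-breaking
order, so that ties are settled by comparing names. Let `x` be the current winner. Once `v` places
`y` at position `p`, the final score of `y` is known, and whether another candidate stays behind `y`
depends only on the position that `v` gives to it. The scoring vector is nonincreasing, so moving
such a candidate down never hurts. Hence `v` can make `y` win while ranking `x` above `y` iff, for
some `q < p`, `x` is harmless at `q` and the remaining candidates can be matched to the remaining
positions. The sets of candidates admissible at a position grow with the position, so Hall's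
condition shrinks to one inequality per position (`exists_preference_iff`, `Reads.placeable_iff`,
`Reads.suspect_iff`). All that remains is a search over `v`, `y`, `x`, `p`, `q`; the empty coalition
never succeeds, so size at most one means a single voter.

For the running time, `PT` is a class of functions of a word and of numbers in unary, computed by
small register programs. Each program step becomes one step of a stack machine (`Runs.reachesIn`).
The class is closed under primitive recursion with polynomially bounded values (`PT.prec`), hence
under bounded sums and bounded quantifiers, and the search is a formula built from these.

The entries of the scoring vector, given in binary, can be exponentially large and must not enter a
register. Total scores are therefore compared digit by digit, reading the digits from the word and
propagating a carry that stays linear in the number of voters (`carry_le`, `carry_lt_iff`).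
Comparing numerators suffices because the common denominator is positive. -/

open Function

/-! ### Register programs

Structured programs over registers holding natural numbers, with a read head on a fixed word. -/

/-- Programs: `test q r` increments `r` if the letter under the head satisfies `q`, and
`loop r p` executes `p` as long as `r` is nonzero, decrementing `r` before each execution. -/
inductive Prog (A : Type) : Type
  | skip : Prog A
  | inc (r : ℕ) : Prog A
  | right : Prog A
  | left : Prog A
  | test (q : A → Bool) (r : ℕ) : Prog A
  | seq (p₁ p₂ : Prog A) : Prog A
  | loop (r : ℕ) (p : Prog A) : Prog A

variable {A : Type}

/-- `Runs s p S h S' h' t`: on the word `s`, the program `p` started with registers `S` and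
head position `h` ends with registers `S'` and head position `h'` after `t` steps. -/
inductive Runs (s : List A) : Prog A → (ℕ → ℕ) → ℕ → (ℕ → ℕ) → ℕ → ℕ → Prop
  | skip {S h} : Runs s .skip S h S h 1
  | inc {S h r} : Runs s (.inc r) S h (update S r (S r + 1)) h 1
  | right {S h} : Runs s .right S h S (if h < s.length then h + 1 else h) 1
  | left {S h} : Runs s .left S h S (h - 1) 1
  | test {S h q r} :
      Runs s (.test q r) S h (if s[h]?.any q then update S r (S r + 1) else S) h 1
  | seq {p₁ p₂ S h S₁ h₁ S₂ h₂ t₁ t₂} : Runs s p₁ S h S₁ h₁ t₁ → Runs s p₂ S₁ h₁ S₂ h₂ t₂ →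
      Runs s (.seq p₁ p₂) S h S₂ h₂ (t₁ + t₂)
  | loop_zero {S h r p} : S r = 0 → Runs s (.loop r p) S h S h 1
  | loop_succ {S h r p n S₁ h₁ S₂ h₂ t₁ t₂} : S r = n + 1 →
      Runs s p (update S r n) h S₁ h₁ t₁ → Runs s (.loop r p) S₁ h₁ S₂ h₂ t₂ →
      Runs s (.loop r p) S h S₂ h₂ (1 + t₁ + t₂)

/-- All registers of the program are smaller than `N`. -/
def Prog.RegsLT (N : ℕ) : Prog A → Prop
  | .skip => True
  | .inc r => r < N
  | .right => True
  | .left => True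
  | .test _ r => r < N
  | .seq p₁ p₂ => p₁.RegsLT N ∧ p₂.RegsLT N
  | .loop r p => r < N ∧ p.RegsLT N

theorem Prog.RegsLT.mono {N N' : ℕ} (h : N ≤ N') : ∀ {p : Prog A}, p.RegsLT N → p.RegsLT N'
  | .skip, _ => trivial
  | .inc _, hp => lt_of_lt_of_le hp h
  | .right, _ => trivial
  | .left, _ => trivial
  | .test _ _, hp => lt_of_lt_of_le hp h
  | .seq _ _, hp => ⟨hp.1.mono h, hp.2.mono h⟩
  | .loop _ _, hp => ⟨lt_of_lt_of_le hp.1 h, hp.2.mono h⟩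

theorem Prog.exists_regsLT : ∀ p : Prog A, ∃ N, p.RegsLT N
  | .skip => ⟨0, trivial⟩
  | .inc r => ⟨r + 1, Nat.lt_succ_self r⟩
  | .right => ⟨0, trivial⟩
  | .left => ⟨0, trivial⟩
  | .test _ r => ⟨r + 1, Nat.lt_succ_self r⟩
  | .seq p₁ p₂ => by
    obtain ⟨N₁, h₁⟩ := p₁.exists_regsLT
    obtain ⟨N₂, h₂⟩ := p₂.exists_regsLT
    exact ⟨max N₁ N₂, h₁.mono (le_max_left _ _), h₂.mono (le_max_right _ _)⟩
  | .loop r p => by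
    obtain ⟨N, h⟩ := p.exists_regsLT
    exact ⟨max (r + 1) N, by omega, h.mono (le_max_right _ _)⟩

/-! ### Compilation to stack machines -/

/-- The stacks of the compiled machine: unary registers, the two halves of the input word
around the head, and the output. -/
inductive Stk (N : ℕ) : Type
  | reg (i : Fin N)
  | before
  | after
  | out
  deriving DecidableEq, Fintype

/-- The alphabets of the stacks. -/
abbrev StkAlphabet (A : Type) (N : ℕ) : Stk N → Type
  | .reg _ => Unit
  | .before => A
  | .after => A
  | .out => Bool

/-- Internal states of the compiled machine: the letter read last and a flag. -/
abbrev MState (A : Type) : Type := Option A × Bool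

/-- The labels of the compiled program. -/
def Prog.Label : Prog A → Type
  | .seq p₁ p₂ => p₁.Label ⊕ p₂.Label
  | .loop _ p => Option p.Label
  | _ => Unit

/-- The label at which the compiled program starts. -/
def Prog.entry : (p : Prog A) → p.Label
  | .seq p₁ _ => Sum.inl p₁.entry
  | .loop _ _ => none
  | .skip => ()
  | .inc _ => ()
  | .right => ()
  | .left => ()
  | .test _ _ => ()

/-- There are finitely many labels. -/
@[reducible]
def Prog.labelFintype : (p : Prog A) → Fintype p.Label
  | .seq p₁ p₂ => @instFintypeSum _ _ p₁.labelFintype p₂.labelFintype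
  | .loop _ p => @instFintypeOption _ p.labelFintype
  | .skip => inferInstanceAs (Fintype Unit)
  | .inc _ => inferInstanceAs (Fintype Unit)
  | .right => inferInstanceAs (Fintype Unit)
  | .left => inferInstanceAs (Fintype Unit)
  | .test _ _ => inferInstanceAs (Fintype Unit)

open Turing TM2.Stmt

/-- The statements of the compiled machine. -/
abbrev MStmt (A : Type) (N : ℕ) (L : Type) : Type := TM2.Stmt (StkAlphabet A N) L (MState A)

/-- Reset the internal state and continue at the label `l`. -/
def resetGoto {N : ℕ} {L : Type} (l : L) : MStmt A N L :=
  load (fun _ => (none, false)) (goto fun _ => l)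

/-- Push one token on the register `r`. -/
def pushReg {N : ℕ} [NeZero N] {L : Type} (r : ℕ) (q : MStmt A N L) : MStmt A N L :=
  push (.reg (Fin.ofNat N r)) (fun _ => ()) q

/-- Pop one token from the register `r` and record in the flag whether there was one. -/
def popReg {N : ℕ} [NeZero N] {L : Type} (r : ℕ) (q : MStmt A N L) : MStmt A N L :=
  pop (.reg (Fin.ofNat N r)) (fun _ (o : Option Unit) => (none, o.isSome)) q

/-- The stacks that represent the registers `S`, the word `s` and the head position `h`. -/
def stkOf (N : ℕ) (s : List A) (S : ℕ → ℕ) (h : ℕ) : (k : Stk N) → List (StkAlphabet A N k)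
  | .reg i => List.replicate (S i) ()
  | .before => (s.take h).reverse
  | .after => s.drop h
  | .out => []

/-! ### Simulation of register programs by the stack machine. -/

/-- `c'` is the configuration reached from `c` after `t` steps. -/
def ReachesIn {C : Type} (f : C → Option C) (c c' : C) (t : ℕ) : Prop :=
  (flip bind f)^[t] (some c) = some c'

theorem ReachesIn.trans {C : Type} {f : C → Option C} {a b c : C} {t₁ t₂ : ℕ}
    (h₁ : ReachesIn f a b t₁) (h₂ : ReachesIn f b c t₂) : ReachesIn f a c (t₁ + t₂) := by
  unfold ReachesIn at *
  rw [add_comm, iterate_add_apply, h₁, h₂]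

theorem ReachesIn.single {C : Type} {f : C → Option C} {a b : C} (h : f a = some b) :
    ReachesIn f a b 1 := h

theorem stkOf_update {N : ℕ} [NeZero N] {s : List A} {S : ℕ → ℕ} {h r n : ℕ} (hr : r < N) :
    stkOf N s (update S r n) h =
      update (stkOf N s S h) (.reg (Fin.ofNat N r)) (List.replicate n ()) := by
  funext k
  cases k with
  | reg i =>
    by_cases hi : i = Fin.ofNat N r
    · subst hi
      rw [update_self]
      change List.replicate (update S r n (r % N)) () = _
      rw [Nat.mod_eq_of_lt hr, update_self]
    · have : (i : ℕ) ≠ r := by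
        rintro rfl
        simp at hi
      have h2 : (Stk.reg i : Stk N) ≠ .reg (Fin.ofNat N r) := by simpa using hi
      rw [update_of_ne h2]
      exact congrArg (fun n => List.replicate n ()) (update_of_ne this _ _)
  | before => rw [update_of_ne (by simp)]; rfl
  | after => rw [update_of_ne (by simp)]; rfl
  | out => rw [update_of_ne (by simp)]; rfl

theorem stkOf_reg {N : ℕ} [NeZero N] {s : List A} {S : ℕ → ℕ} {h r : ℕ} (hr : r < N) :
    stkOf N s S h (.reg (Fin.ofNat N r)) = List.replicate (S r) () := by
  change List.replicate (S (r % N)) () = _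
  rw [Nat.mod_eq_of_lt hr]

theorem stkOf_right {N : ℕ} {s : List A} {S : ℕ → ℕ} {h : ℕ} (hh : h < s.length) :
    stkOf N s S (h + 1) = update (update (stkOf N s S h) .after (s.drop (h + 1))) .before
      (s[h] :: (s.take h).reverse) := by
  funext k
  cases k with
  | reg i => rw [update_of_ne (by simp), update_of_ne (by simp)]; rfl
  | before =>
    rw [update_self]
    change (s.take (h + 1)).reverse = _
    rw [List.take_succ_eq_append_getElem hh]
    simp
  | after => rw [update_of_ne (by simp), update_self]; rfl
  | out => rw [update_of_ne (by simp), update_of_ne (by simp)]; rfl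

theorem stkOf_left {N : ℕ} {s : List A} {S : ℕ → ℕ} {h : ℕ} (hh : h < s.length) :
    stkOf N s S h = update (update (stkOf N s S (h + 1)) .before (s.take h).reverse) .after
      (s[h] :: s.drop (h + 1)) := by
  funext k
  cases k with
  | reg i => rw [update_of_ne (by simp), update_of_ne (by simp)]; rfl
  | before => rw [update_of_ne (by simp), update_self]; rfl
  | after =>
    rw [update_self]
    change s.drop h = _
    rw [List.drop_eq_getElem_cons hh]
  | out => rw [update_of_ne (by simp), update_of_ne (by simp)]; rfl

/-- Beyond the end of the word the two stacks around the head no longer determine its position, so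
the simulation needs the head to stay in range. -/
theorem Runs.head_le {s : List A} {p : Prog A} {S S' : ℕ → ℕ} {h h' t : ℕ}
    (hr : Runs s p S h S' h' t) : h ≤ s.length → h' ≤ s.length := by
  induction hr with
  | skip | inc | test | loop_zero => exact id
  | right => intro h; split_ifs <;> omega
  | left => intro h; omega
  | seq _ _ ih₁ ih₂ => exact ih₂ ∘ ih₁
  | loop_succ _ _ _ ih₁ ih₂ => exact ih₂ ∘ ih₁

variable [Inhabited A]

/-- The code of a program whose labels are embedded in `L` by `emb`; it continues at `exit`. -/
def Prog.code (N : ℕ) [NeZero N] {L : Type} :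
    (p : Prog A) → (emb : p.Label → L) → (exit : L) → p.Label → MStmt A N L
  | .skip, _, exit, _ => resetGoto exit
  | .inc r, _, exit, _ => pushReg r (resetGoto exit)
  | .right, _, exit, _ =>
      pop .after (fun _ (o : Option A) => (o, false))
        (branch (fun v => v.1.isSome)
          (push .before (fun v => (v.1.getD default : A)) (resetGoto exit))
          (resetGoto exit))
  | .left, _, exit, _ =>
      pop .before (fun _ (o : Option A) => (o, false))
        (branch (fun v => v.1.isSome)
          (push .after (fun v => (v.1.getD default : A)) (resetGoto exit))
          (resetGoto exit))
  | .test q r, _, exit, _ =>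
      peek .after (fun _ (o : Option A) => (o, false))
        (branch (fun v => v.1.any q) (pushReg r (resetGoto exit)) (resetGoto exit))
  | .seq p₁ p₂, emb, _, Sum.inl l => p₁.code N (emb ∘ Sum.inl) (emb (Sum.inr p₂.entry)) l
  | .seq _ p₂, emb, exit, Sum.inr l => p₂.code N (emb ∘ Sum.inr) exit l
  | .loop r p, emb, exit, none =>
      popReg r (branch (fun v => v.2) (resetGoto (emb (some p.entry))) (resetGoto exit))
  | .loop _ p, emb, _, some l => p.code N (emb ∘ some) (emb none) l

/-- The compiled code simulates the program step by step. -/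
theorem Runs.reachesIn {N : ℕ} [NeZero N] {L : Type} {M : L → MStmt A N L} {s : List A}
    {p : Prog A} {S S' : ℕ → ℕ} {h h' t : ℕ} (hr : Runs s p S h S' h' t) :
    h ≤ s.length → p.RegsLT N → ∀ (emb : p.Label → L) (exit : L),
      (∀ l, M (emb l) = p.code N emb exit l) →
      ReachesIn (TM2.step M) ⟨some (emb p.entry), (none, false), stkOf N s S h⟩
        ⟨some exit, (none, false), stkOf N s S' h'⟩ t := by
  induction hr with
  | skip =>
    intro _ _ emb exit hM
    apply ReachesIn.single
    rw [TM2.step, hM]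
    simp [Prog.code, resetGoto]
  | inc =>
    intro _ hN emb exit hM
    apply ReachesIn.single
    rw [TM2.step, hM]
    simp only [Prog.code, resetGoto, pushReg, TM2.stepAux, stkOf_update hN, stkOf_reg hN]
    rfl
  | @right S h =>
    intro _ _ emb exit hM
    apply ReachesIn.single
    rw [TM2.step, hM]
    by_cases hh : h < s.length
    · rw [if_pos hh, stkOf_right hh]
      have e : stkOf N s S h .after = s[h] :: s.drop (h + 1) := List.drop_eq_getElem_cons hh
      simp only [Prog.code, resetGoto, TM2.stepAux, e]
      rfl
    · rw [if_neg hh]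
      have e : stkOf N s S h .after = [] := List.drop_eq_nil_of_le (not_lt.1 hh)
      have e2 : update (stkOf N s S h) .after [] = stkOf N s S h := by
        rw [← e, update_eq_self]
      simp only [Prog.code, resetGoto, TM2.stepAux, e]
      simp [e2]
  | @left S h =>
    intro hl _ emb exit hM
    apply ReachesIn.single
    rw [TM2.step, hM]
    cases h with
    | zero =>
      have e : stkOf N s S 0 .before = [] := rfl
      have e2 : update (stkOf N s S 0) .before [] = stkOf N s S 0 := by
        rw [← e, update_eq_self]
      simp only [Prog.code, resetGoto, TM2.stepAux, e]
      simp [e2]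
    | succ h =>
      have hh : h < s.length := hl
      rw [Nat.add_sub_cancel, stkOf_left hh]
      have e : stkOf N s S (h + 1) .before = s[h] :: (s.take h).reverse := by
        change (s.take (h + 1)).reverse = _
        rw [List.take_succ_eq_append_getElem hh]
        simp
      simp only [Prog.code, resetGoto, TM2.stepAux, e]
      rfl
  | @test S h q r =>
    intro _ hN emb exit hM
    apply ReachesIn.single
    rw [TM2.step, hM]
    have e : (stkOf N s S h .after).head? = s[h]? := by
      change (s.drop h).head? = _
      simp
    simp only [Prog.code, TM2.stepAux]
    rw [e]
    by_cases ht : s[h]?.any q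
    · rw [if_pos ht, ht]
      simp only [resetGoto, pushReg, TM2.stepAux, stkOf_update (show r < N from hN),
        stkOf_reg (show r < N from hN)]
      rfl
    · rw [if_neg ht, Bool.eq_false_iff.2 ht]
      simp [resetGoto]
  | seq hr₁ _ ih₁ ih₂ =>
    intro hl hN emb exit hM
    exact (ih₁ hl hN.1 _ _ fun l => hM (Sum.inl l)).trans
      (ih₂ (hr₁.head_le hl) hN.2 _ _ fun l => hM (Sum.inr l))
  | @loop_zero S h r p h0 =>
    intro _ hN emb exit hM
    apply ReachesIn.single
    have e : stkOf N s S h (.reg (Fin.ofNat N r)) = [] := by rw [stkOf_reg hN.1, h0]; rfl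
    have e2 : update (stkOf N s S h) (.reg (Fin.ofNat N r)) [] = stkOf N s S h := by
      rw [← e, update_eq_self]
    rw [TM2.step, hM]
    simp only [Prog.entry, Prog.code, popReg, resetGoto, TM2.stepAux, e, List.tail_nil, e2]
    rfl
  | @loop_succ S h r p n S₁ h₁ S₂ h₂ t₁ t₂ h0 hr₁ _ ih₁ ih₂ =>
    intro hl hN emb exit hM
    -- The compiled body exits to the loop's own label, so the hypothesis for the rest of the loop
    -- takes over where the body ends.
    refine ReachesIn.trans (ReachesIn.trans (ReachesIn.single ?_)
      (ih₁ hl hN.2 (emb ∘ some) (emb none) fun l => hM (some l)))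
      (ih₂ (hr₁.head_le hl) hN emb exit hM)
    have e : stkOf N s S h (.reg (Fin.ofNat N r)) = () :: List.replicate n () := by
      rw [stkOf_reg hN.1, h0]; rfl
    rw [TM2.step, hM, stkOf_update hN.1]
    simp only [Prog.entry, Prog.code, popReg, resetGoto, TM2.stepAux, e]
    rfl

/-! ### From programs to deciding machines. -/

/-- The labels of the machine that decides by means of the program `p`: first `p` is executed,
then the answer is written, then the input is erased. -/
abbrev DeciderLabel (p : Prog A) : Type := p.Label ⊕ Bool

/-- The code of the decider. -/
def deciderCode (N : ℕ) [NeZero N] (p : Prog A) : DeciderLabel p → MStmt A N (DeciderLabel p)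
  | Sum.inl l => p.code N Sum.inl (Sum.inr false) l
  | Sum.inr false =>
      popReg 0 (push .out (fun v => v.2) (resetGoto (Sum.inr true)))
  | Sum.inr true =>
      pop .after (fun _ (o : Option A) => (o, false))
        (branch (fun v => v.1.isSome) (resetGoto (Sum.inr true))
          (load (fun _ => (none, false)) halt))

/-- The machine that decides by means of the program `p`. -/
def decider [Fintype A] (N : ℕ) [NeZero N] (p : Prog A) : FinTM2 where
  K := Stk N
  k₀ := .after
  k₁ := .out
  Γ := StkAlphabet A N
  Λ := DeciderLabel p
  main := Sum.inl p.entry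
  ΛFin := @instFintypeSum _ _ p.labelFintype _
  σ := MState A
  initialState := (none, false)
  Γk₀Fin := inferInstanceAs (Fintype A)
  m := deciderCode N p

/-- The stacks during the final phase of the decider. -/
def finalStacks (N : ℕ) (s : List A) (b : Bool) : (k : Stk N) → List (StkAlphabet A N k)
  | .reg _ => []
  | .before => []
  | .after => s
  | .out => [b]

/-- A halting configuration must have all stacks but the output empty, so the input is popped letter
by letter; the extra step detects the empty stack and halts. -/
theorem reachesIn_erase (N : ℕ) [NeZero N] (p : Prog A) (b : Bool) (s : List A) :
    ReachesIn (TM2.step (deciderCode N p)) ⟨some (Sum.inr true), (none, false), finalStacks N s b⟩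
        ⟨none, (none, false), finalStacks N [] b⟩ (s.length + 1) := by
  have key : ∀ s s' : List A, update (finalStacks N s b) .after s' = finalStacks N s' b := by
    intro s s'
    funext k
    cases k with
    | after => rw [update_self]; rfl
    | _ => rw [update_of_ne (by simp)]; rfl
  induction s with
  | nil =>
    apply ReachesIn.single
    rw [TM2.step]
    have e : finalStacks N ([] : List A) b .after = [] := rfl
    simp only [deciderCode, TM2.stepAux, e]
    have := key [] []
    simp [this]
  | cons x s ih =>
    rw [List.length_cons, add_comm]
    refine ReachesIn.trans (ReachesIn.single ?_) ih
    rw [TM2.step]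
    have e : finalStacks N (x :: s) b .after = x :: s := rfl
    simp only [deciderCode, resetGoto, TM2.stepAux, e]
    have := key (x :: s) s
    simp [this]

/-- One step pops register `0` and writes whether there was a token. All other registers are zero
and the head is back at the start, so only the input is left to erase. -/
theorem Runs.decider {N : ℕ} [NeZero N] {p : Prog A} (hp : p.RegsLT N) {s : List A} {b : Bool}
    {t : ℕ} (hr : Runs s p (fun _ => 0) 0 (update (fun _ => 0) 0 b.toNat) 0 t) :
    ReachesIn (TM2.step (deciderCode N p))
      ⟨some (Sum.inl p.entry), (none, false), stkOf N s (fun _ => 0) 0⟩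
      ⟨none, (none, false), finalStacks N [] b⟩ (t + 1 + (s.length + 1)) := by
  refine ReachesIn.trans (ReachesIn.trans
    (hr.reachesIn (M := deciderCode N p) (Nat.zero_le _) hp Sum.inl (Sum.inr false) fun l => rfl)
    (ReachesIn.single ?_)) (reachesIn_erase N p b s)
  rw [TM2.step]
  have h0 : 0 < N := Nat.pos_of_ne_zero (NeZero.ne N)
  rw [stkOf_update h0]
  simp only [deciderCode, popReg, resetGoto, TM2.stepAux, update_self, update_idem]
  have e : ∀ l : List Unit, l = [] → ∀ o : List Bool, o = [b] →
      update (update (stkOf N s (fun _ => 0) 0) (.reg (Fin.ofNat N 0)) l) .out o =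
      finalStacks N s b := by
    rintro l rfl o rfl
    funext k
    cases k with
    | out => rw [update_self]; rfl
    | reg i =>
      rw [update_of_ne (by simp)]
      by_cases hi : i = Fin.ofNat N 0
      · subst hi; rw [update_self]; rfl
      · rw [update_of_ne (by simpa using hi)]; rfl
    | before => rw [update_of_ne (by simp), update_of_ne (by simp)]; rfl
    | after => rw [update_of_ne (by simp), update_of_ne (by simp)]; rfl
  congr 2
  refine e _ ?_ _ ?_
  · cases b <;> rfl
  · rw [update_of_ne (by simp)]
    cases b <;> rfl

/-- A program that computes the characteristic function of a decision problem in polynomial time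
yields a Turing machine that decides it in polynomial time. -/
theorem inP_of_runs [Fintype A] {I : Type} {enc : I → List A} {Yes : I → Prop} (f : I → Bool)
    (hf : ∀ a, f a = true ↔ Yes a) (p : Prog A) (T : Polynomial ℕ)
    (h : ∀ a, ∃ t ≤ T.eval (enc a).length,
      Runs (enc a) p (fun _ => 0) 0 (update (fun _ => 0) 0 (f a).toNat) 0 t) :
    InP enc Yes := by
  obtain ⟨N, hN⟩ := p.exists_regsLT
  have hN' : p.RegsLT (N + 1) := hN.mono (Nat.le_succ N)
  choose t ht hr using h
  refine ⟨f, hf, ⟨{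
    tm := decider (N + 1) p
    inputAlphabet := Equiv.refl A
    outputAlphabet := Equiv.refl Bool
    time := T + Polynomial.X + 2
    outputsFun := fun a => ⟨⟨t a + 1 + ((enc a).length + 1), ?_⟩, ?_⟩ }⟩⟩
  · have e₁ : initList (decider (N + 1) p) (List.map (Equiv.refl A).invFun (enc a)) =
        ⟨some (Sum.inl p.entry), (none, false), stkOf (N + 1) (enc a) (fun _ => 0) 0⟩ := by
      unfold initList
      congr 1
      funext k
      cases k with
      | after =>
        refine (dif_pos rfl).trans ?_
        exact List.map_id _
      | _ => exact dif_neg (by simp [decider])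
    have e₂ : haltList (decider (N + 1) p) (List.map (Equiv.refl Bool).invFun
        (Computability.encodeBool (f a))) =
        ⟨none, (none, false), finalStacks (N + 1) [] (f a)⟩ := by
      unfold haltList
      congr 1
      funext k
      cases k with
      | out =>
        refine (dif_pos rfl).trans ?_
        rfl
      | _ => exact dif_neg (by simp [decider])
    have := (hr a).decider hN'
    exact (congrArg (fun c => (flip bind (decider (N + 1) p).step)^[t a + 1 + ((enc a).length + 1)]
      (some c)) e₁).trans (Eq.trans this (congrArg some e₂.symm))
  · have := ht a
    simp only [Polynomial.eval_add, Polynomial.eval_X, Polynomial.eval_ofNat]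
    omega

end PossibleManipulators

namespace PossibleManipulators

open Function Finset

variable {A : Type}

/-! ### Running programs with time bounds -/

theorem Polynomial.eval_monotone_nat (p : Polynomial ℕ) : Monotone fun n => p.eval n := by
  intro x y h
  induction p using Polynomial.induction_on' with
  | add p q hp hq => simpa using add_le_add hp hq
  | monomial n a => simpa using Nat.mul_le_mul_left a (Nat.pow_le_pow_left h n)

/-- The program runs in at most `T` steps. -/
def RunsLE (s : List A) (p : Prog A) (S : ℕ → ℕ) (h : ℕ) (S' : ℕ → ℕ) (h' T : ℕ) : Prop :=
  ∃ t ≤ T, Runs s p S h S' h' t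

theorem Runs.le {s : List A} {p : Prog A} {S S' : ℕ → ℕ} {h h' t : ℕ}
    (hr : Runs s p S h S' h' t) : RunsLE s p S h S' h' t := ⟨t, le_rfl, hr⟩

theorem RunsLE.mono {s : List A} {p : Prog A} {S S' : ℕ → ℕ} {h h' T T' : ℕ}
    (hr : RunsLE s p S h S' h' T) (hT : T ≤ T') : RunsLE s p S h S' h' T' := by
  obtain ⟨t, ht, hr⟩ := hr
  exact ⟨t, ht.trans hT, hr⟩

theorem RunsLE.seq {s : List A} {p₁ p₂ : Prog A} {S S₁ S₂ : ℕ → ℕ} {h h₁ h₂ T₁ T₂ : ℕ}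
    (hr₁ : RunsLE s p₁ S h S₁ h₁ T₁) (hr₂ : RunsLE s p₂ S₁ h₁ S₂ h₂ T₂) :
    RunsLE s (.seq p₁ p₂) S h S₂ h₂ (T₁ + T₂) := by
  obtain ⟨t₁, ht₁, hr₁⟩ := hr₁
  obtain ⟨t₂, ht₂, hr₂⟩ := hr₂
  exact ⟨t₁ + t₂, add_le_add ht₁ ht₂, hr₁.seq hr₂⟩

/-- The rule for counted loops: `σ i` and `H i` describe the state before round `i`. Each round
costs one extra step for the test, and the failing test costs the last step. -/
theorem RunsLE.loop {s : List A} {p : Prog A} {r n T : ℕ} {σ : ℕ → ℕ → ℕ} {H : ℕ → ℕ}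
    (hσ : ∀ i ≤ n, σ i r = n - i)
    (hstep : ∀ i < n, RunsLE s p (update (σ i) r (n - i - 1)) (H i) (σ (i + 1)) (H (i + 1)) T) :
    RunsLE s (.loop r p) (σ 0) (H 0) (σ n) (H n) (n * (T + 1) + 1) := by
  induction n generalizing σ H with
  | zero => exact ⟨1, by omega, Runs.loop_zero (hσ 0 le_rfl)⟩
  | succ n ih =>
    obtain ⟨t₁, ht₁, hr₁⟩ := hstep 0 (Nat.succ_pos n)
    obtain ⟨t₂, ht₂, hr₂⟩ := @ih (fun i => σ (i + 1)) (fun i => H (i + 1))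
      (fun i hi => by rw [hσ (i + 1) (by omega)]; omega)
      (fun i hi => by
        have := hstep (i + 1) (by omega)
        rwa [show n + 1 - (i + 1) - 1 = n - i - 1 by omega] at this)
    refine ⟨1 + t₁ + t₂, by nlinarith, Runs.loop_succ (hσ 0 (Nat.zero_le _)) ?_ hr₂⟩
    simpa using hr₁

theorem runsLE_clear (s : List A) (S : ℕ → ℕ) (h r : ℕ) :
    RunsLE s (.loop r .skip) S h (update S r 0) h (S r * 2 + 1) := by
  have := @RunsLE.loop A s .skip r (S r) 1 (fun i => update S r (S r - i)) (fun _ => h)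
    (fun i hi => by simp) (fun i hi => by
      have := (Runs.skip (s := s) (S := update (update S r (S r - i)) r (S r - i - 1))
        (h := h)).le
      rw [update_idem] at this
      rwa [update_idem])
  simpa using this

theorem runsLE_move (s : List A) (S : ℕ → ℕ) (h : ℕ) {r o : ℕ} (hro : r ≠ o) :
    RunsLE s (.loop r (.inc o)) S h (update (update S r 0) o (S o + S r)) h (S r * 2 + 1) := by
  have := @RunsLE.loop A s (.inc o) r (S r) 1
    (fun i => update (update S r (S r - i)) o (S o + i)) (fun _ => h)
    (fun i hi => by simp [update_of_ne hro]) (fun i hi => by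
      convert (Runs.inc (s := s)).le using 1
      funext x
      simp only [update_apply]
      split_ifs <;> grind)
  simpa using this

/-! ### Functions computable in polynomial time from a word and numbers in unary -/

/-- Elements of `α` consist of a word and of `arity` many natural numbers. -/
class Ctx (A : outParam Type) (α : Type) where
  /-- the word -/
  str : α → List A
  /-- the number of numbers -/
  arity : ℕ
  /-- the numbers -/
  var : α → ℕ → ℕ

instance (A : Type) : Ctx A (List A) where
  str s := s
  arity := 0
  var _ _ := 0

/-- Bound variables of sums and quantifiers are appended on the right, one factor `ℕ` for each. -/
instance (A α : Type) [Ctx A α] : Ctx A (α × ℕ) where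
  str p := Ctx.str p.1
  arity := Ctx.arity α + 1
  var p i := if i = Ctx.arity α then p.2 else Ctx.var p.1 i

open Ctx

/-- The size of a context: all numbers count in unary. -/
def Ctx.size {α : Type} [Ctx A α] (a : α) : ℕ := (str a).length + ∑ i ∈ range (arity α), var a i

theorem Ctx.size_prod {α : Type} [Ctx A α] (a : α) (n : ℕ) : size (a, n) = size a + n := by
  unfold size
  change (str a).length + ∑ i ∈ range (arity α + 1), (if i = arity α then n else var a i) = _
  rw [Finset.sum_range_succ, if_pos rfl, add_assoc]
  congr 2
  exact Finset.sum_congr rfl fun i hi => if_neg (Finset.mem_range.1 hi).ne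

theorem Ctx.var_le_size {α : Type} [Ctx A α] (a : α) {i : ℕ} (hi : i < arity α) :
    var a i ≤ size a :=
  (Finset.single_le_sum (f := var a) (fun _ _ => Nat.zero_le _) (Finset.mem_range.2 hi)).trans
    (Nat.le_add_left _ _)

/-- The registers `S` hold the numbers of the context `a` at the locations `loc`, the output
register `o` is zero, and so are all registers from `b` on. -/
structure Holds {α : Type} [Ctx A α] (loc : ℕ → ℕ) (o b : ℕ) (a : α) (S : ℕ → ℕ) : Prop where
  var : ∀ i < arity α, S (loc i) = var a i
  out : S o = 0
  scratch : ∀ r, b ≤ r → S r = 0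

/-- The locations of the numbers differ from the output register `o`, and all of them are less
than the first scratch register `b`. -/
structure Alloc (k : ℕ) (loc : ℕ → ℕ) (o b : ℕ) : Prop where
  lt : ∀ i < k, loc i < b
  ne : ∀ i < k, loc i ≠ o
  out_lt : o < b

/-- The program writes `f a` to the register `o` in time `T`, and leaves all else unchanged. -/
def ProgComputes {α : Type} [Ctx A α] (f : α → ℕ) (T : Polynomial ℕ) (loc : ℕ → ℕ) (o b : ℕ)
    (p : Prog A) : Prop :=
  ∀ a S, Holds loc o b a S → RunsLE (str a) p S 0 (update S o (f a)) 0 (T.eval (size a))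

/-- The function `f` has polynomially bounded values and is computed in polynomial time by
register programs. -/
def PT {α : Type} [Ctx A α] (f : α → ℕ) : Prop :=
  ∃ T : Polynomial ℕ, (∀ a, f a ≤ T.eval (size a)) ∧
    ∀ loc o b, Alloc (arity α) loc o b → ∃ p, ProgComputes f T loc o b p

/-! ### Basic functions, primitive recursion and reading of letters. -/

section

variable {α : Type} [Ctx A α]

/-- A loop destroys the register it reads, so the value is moved to the output and to a scratch
register at once and then restored. The two loops take `3 * v + 1` and `2 * v + 1` steps for the
value `v`. -/
theorem PT.var {i : ℕ} (hi : i < arity α) : PT fun a : α => var a i := by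
  refine ⟨5 * Polynomial.X + 2, fun a => ?_, fun loc o b h =>
    ⟨.seq (.loop (loc i) (.seq (.inc b) (.inc o))) (.loop b (.inc (loc i))), fun a S hS => ?_⟩⟩
  · have := var_le_size a hi
    simp
    omega
  have h₁ := h.lt i hi
  have h₂ := h.ne i hi
  have h₃ := h.out_lt
  have hv := hS.var i hi
  have ho := hS.out
  have hb := hS.scratch b le_rfl
  have r₁ := @RunsLE.loop A (str a) (.seq (.inc b) (.inc o)) (loc i) (Ctx.var a i) 2
    (fun k => update (update (update S (loc i) (Ctx.var a i - k)) b k) o k) (fun _ => 0)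
    (fun k hk => by simp [update_apply]; grind) (fun k hk => by
      have := ((Runs.inc (s := str a) (S := update (update (update (update S (loc i)
        (Ctx.var a i - k)) b k) o k) (loc i) (Ctx.var a i - k - 1)) (h := 0) (r := b)).seq
        (Runs.inc (r := o))).le
      convert this using 1
      funext x
      simp only [update_apply]
      grind)
  have r₂ := runsLE_move (str a)
    (update (update (update S (loc i) (Ctx.var a i - Ctx.var a i)) b (Ctx.var a i)) o (Ctx.var a i))
    0 (r := b) (o := loc i) h₁.ne'
  have r := r₁.seq r₂
  have e₀ : update (update (update S (loc i) (Ctx.var a i - 0)) b 0) o 0 = S := by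
    funext x
    simp only [update_apply]
    grind
  simp only [e₀] at r
  convert r.mono ?_ using 1
  · funext x
    simp only [update_apply]
    grind
  · have := var_le_size a hi
    simp [h₃.ne']
    omega

theorem PT.zero : PT fun _ : α => 0 :=
  ⟨1, fun _ => by simp, fun loc o b _ => ⟨.skip, fun a S hS => by
    have := (Runs.skip (s := str a) (S := S) (h := 0)).le
    have e : update S o 0 = S := by
      conv_lhs => rw [← hS.out]
      exact update_eq_self _ _
    rw [e]
    simpa using this⟩⟩

theorem PT.succ {f : α → ℕ} (hf : PT f) : PT fun a => f a + 1 := by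
  obtain ⟨T, hT, hp⟩ := hf
  refine ⟨T + 1, fun a => by simpa using hT a, fun loc o b h => ?_⟩
  obtain ⟨p, hp⟩ := hp loc o b h
  refine ⟨.seq p (.inc o), fun a S hS => ?_⟩
  have := (hp a S hS).seq (Runs.inc (r := o)).le
  rw [update_idem, update_self] at this
  simpa using this

/-- Functions may ignore the last number of the context. -/
theorem PT.weaken {f : α → ℕ} (hf : PT f) : PT fun p : α × ℕ => f p.1 := by
  obtain ⟨T, hT, hp⟩ := hf
  have hev : ∀ p : α × ℕ, T.eval (size p.1) ≤ T.eval (size p) := fun p =>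
    Polynomial.eval_monotone_nat T (by rw [← Prod.eta p, size_prod]; exact Nat.le_add_right _ _)
  refine ⟨T, fun p => (hT p.1).trans (hev p), fun loc o b hl => ?_⟩
  obtain ⟨p, hp⟩ := hp loc o b ⟨fun i hi => hl.lt i (hi.trans (Nat.lt_succ_self _)),
    fun i hi => hl.ne i (hi.trans (Nat.lt_succ_self _)), hl.out_lt⟩
  refine ⟨p, fun a S hS => (hp a.1 S ⟨fun i hi => ?_, hS.out, hS.scratch⟩).mono (hev a)⟩
  exact (hS.var i (hi.trans (Nat.lt_succ_self _))).trans (if_neg hi.ne)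

/-- The last number of the context. -/
theorem PT.last : PT fun p : α × ℕ => p.2 := by
  have := PT.var (α := α × ℕ) (Nat.lt_succ_self (arity α))
  convert this using 2
  exact (if_pos rfl).symm

/-- Primitive recursion with polynomially bounded values. -/
theorem PT.prec {g n : α → ℕ} {h : (α × ℕ) × ℕ → ℕ} {f : α → ℕ → ℕ} (hg : PT g) (hh : PT h)
    (hn : PT n) (h0 : ∀ a, f a 0 = g a) (hs : ∀ a i, f a (i + 1) = h ((a, i), f a i))
    (Q : Polynomial ℕ) (hQ : ∀ a, ∀ i ≤ n a, f a i ≤ Q.eval (size a)) :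
    PT fun a => f a (n a) := by
  obtain ⟨Tg, hTg, hpg⟩ := hg
  obtain ⟨Th, hTh, hph⟩ := hh
  obtain ⟨Tn, hTn, hpn⟩ := hn
  have hev : ∀ a, ∀ i ≤ n a, Th.eval (size ((a, i), f a i)) ≤
      (Th.comp (Polynomial.X + Tn + Q)).eval (size a) := by
    intro a i hi
    rw [Polynomial.eval_comp, size_prod, size_prod]
    apply Polynomial.eval_monotone_nat Th
    have h₁ := hTn a
    have h₂ := hQ a i hi
    simp only [Polynomial.eval_add, Polynomial.eval_X]
    omega
  -- The summands pay for `n`, for `g`, for the rounds (compute `h`, clear the old value, move the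
  -- new one, increment the index) and for clearing the index; the final `Q` is there to bound the
  -- value.
  refine ⟨Tn + Tg + (Tn * (Th.comp (Polynomial.X + Tn + Q) + (Q * 2 + 1) + (Q * 2 + 1) + 1 + 1) + 1)
    + (Tn * 2 + 1) + Q, fun a => ?_, fun loc o b hl => ?_⟩
  · have := hQ a (n a) le_rfl
    simp only [Polynomial.eval_add]
    omega
  have hob := hl.out_lt
  obtain ⟨pn, hpn⟩ := hpn loc b (b + 1)
    ⟨fun i hi => (hl.lt i hi).trans (Nat.lt_succ_self b), fun i hi => (hl.lt i hi).ne,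
      Nat.lt_succ_self b⟩
  obtain ⟨pg, hpg⟩ := hpg loc o (b + 1)
    ⟨fun i hi => (hl.lt i hi).trans (Nat.lt_succ_self b), hl.ne, by omega⟩
  -- Register `b` counts the remaining rounds, `b + 1` holds the index and `o` the current value.
  -- Since `h` reads `o`, its result goes to `b + 2` first.
  obtain ⟨ph, hph⟩ := hph (update (update loc (arity α) (b + 1)) (arity α + 1) o) (b + 2) (b + 3)
    (by
      refine ⟨fun i hi => ?_, fun i hi => ?_, by omega⟩
      all_goals
        change i < arity α + 1 + 1 at hi
        have h₁ := hl.lt i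
        simp only [update_apply]
        split_ifs
        · omega
        · omega
        · have := h₁ (by omega)
          omega)
  refine ⟨.seq (.seq (.seq pn pg) (.loop b (.seq (.seq (.seq ph (.loop o .skip))
    (.loop (b + 2) (.inc o))) (.inc (b + 1))))) (.loop (b + 1) .skip), fun a S hS => ?_⟩
  have hb := hS.scratch
  have hb0 := hb b le_rfl
  have hb1 := hb (b + 1) (by omega)
  have hb2 := hb (b + 2) (by omega)
  have ho := hS.out
  have r₁ := hpn a S ⟨hS.var, hb0, fun r hr => hb r (by omega)⟩
  have r₂ := hpg a (update S b (n a)) ⟨fun i hi => by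
      rw [update_of_ne (hl.lt i hi).ne, hS.var i hi], by rw [update_of_ne hob.ne, ho],
    fun r hr => by rw [update_of_ne (by omega), hb r (by omega)]⟩
  have r₃ := @RunsLE.loop A (str a) (.seq (.seq (.seq ph (.loop o .skip))
    (.loop (b + 2) (.inc o))) (.inc (b + 1))) b (n a)
    ((Th.comp (Polynomial.X + Tn + Q)).eval (size a) + (Q.eval (size a) * 2 + 1) +
      (Q.eval (size a) * 2 + 1) + 1)
    (fun i => update (update (update S b (n a - i)) (b + 1) i) o (f a i)) (fun _ => 0)
    (fun i hi => by
      rw [update_of_ne hob.ne', update_of_ne (by omega), update_self])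
    (fun i hi => by
      have q₁ := hph ((a, i), f a i)
        (update (update (update (update S b (n a - i)) (b + 1) i) o (f a i)) b (n a - i - 1)) (by
        refine ⟨fun k hk => ?_, ?_, fun r hr => ?_⟩
        · change k < arity α + 1 + 1 at hk
          change _ = if k = arity α + 1 then f a i else if k = arity α then i else Ctx.var a k
          have h₁ := hl.lt k
          have h₂ := hl.ne k
          have h₃ := hS.var k
          simp only [update_apply]
          grind
        · simp only [update_apply]
          grind
        · have := hb r (by omega)
          simp only [update_apply]
          grind)
      have q₂ := runsLE_clear (str a) (update (update (update (update (update S b (n a - i))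
        (b + 1) i) o (f a i)) b (n a - i - 1)) (b + 2) (h ((a, i), f a i))) 0 o
      have q₃ := runsLE_move (str a) (update (update (update (update (update (update S b (n a - i))
        (b + 1) i) o (f a i)) b (n a - i - 1)) (b + 2) (h ((a, i), f a i))) o 0) 0 (r := b + 2)
        (o := o) (by omega)
      have q₄ := (Runs.inc (s := str a) (S := update (update (update (update (update (update
        (update (update S b (n a - i))
        (b + 1) i) o (f a i)) b (n a - i - 1)) (b + 2) (h ((a, i), f a i))) o 0) (b + 2) 0) o
        (0 + h ((a, i), f a i))) (h := 0) (r := b + 1)).le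
      have e₁ : ∀ S : ℕ → ℕ, update (update S (b + 2) (h ((a, i), f a i))) o 0 (b + 2) =
          h ((a, i), f a i) := by
        intro S
        rw [update_of_ne (by omega), update_self]
      have e₂ : ∀ S : ℕ → ℕ, update S o 0 o = 0 := fun S => update_self _ _ _
      rw [e₁, e₂] at q₃
      have q := (((show RunsLE (str a) _ _ _ _ _ _ from q₁).seq q₂).seq q₃).seq q₄
      rw [hs]
      convert q.mono ?_ using 1
      · funext x
        simp only [update_apply]
        grind
      · have h₁ := hev a i hi.le
        have h₂ := hQ a i hi.le
        have h₃ := hQ a (i + 1) hi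
        rw [hs] at h₃
        have e₃ : update (update (update (update (update S b (n a - i))
            (b + 1) i) o (f a i)) b (n a - i - 1)) (b + 2) (h ((a, i), f a i)) o = f a i := by
          simp only [update_apply]
          grind
        rw [e₃]
        omega)
  have r₄ := runsLE_clear (str a)
    (update (update (update S b (n a - n a)) (b + 1) (n a)) o (f a (n a))) 0 (b + 1)
  have e₁ : update (update (update S b (n a - 0)) (b + 1) 0) o (f a 0) =
      update (update S b (n a)) o (g a) := by
    rw [h0]
    funext x
    simp only [update_apply]
    grind
  have e₂ : update (update (update (update S b (n a - n a)) (b + 1) (n a)) o (f a (n a))) (b + 1) 0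
      = update S o (f a (n a)) := by
    funext x
    simp only [update_apply]
    grind
  simp only [e₁] at r₃
  rw [e₂] at r₄
  refine (((r₁.seq r₂).seq r₃).seq r₄).mono ?_
  have h₁ := hTn a
  have e₃ : update (update (update S b (n a - n a)) (b + 1) (n a)) o (f a (n a)) (b + 1) = n a := by
    simp only [update_apply]
    grind
  rw [e₃]
  simp only [Polynomial.eval_add, Polynomial.eval_mul, Polynomial.eval_ofNat, Polynomial.eval_one]
  have := Nat.mul_le_mul_right ((Th.comp (Polynomial.X + Tn + Q)).eval (size a) +
    (Q.eval (size a) * 2 + 1) + (Q.eval (size a) * 2 + 1) + 1 + 1) h₁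
  omega

/-- Reading a letter of the word. -/
theorem PT.letter {x : α → ℕ} (hx : PT x) (q : A → Bool) :
    PT fun a => if (str a)[x a]?.any q then 1 else 0 := by
  obtain ⟨T, hT, hp⟩ := hx
  refine ⟨T + (T * 3 + 1) + 1 + (T * 2 + 1), fun a => ?_, fun loc o b hl => ?_⟩
  · simp only [Polynomial.eval_add, Polynomial.eval_one]
    split_ifs <;> omega
  have hob := hl.out_lt
  obtain ⟨p, hp⟩ := hp loc b (b + 1)
    ⟨fun i hi => (hl.lt i hi).trans (Nat.lt_succ_self b), fun i hi => (hl.lt i hi).ne,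
      Nat.lt_succ_self b⟩
  refine ⟨.seq (.seq (.seq p (.loop b (.seq .right (.inc (b + 1))))) (.test q o))
    (.loop (b + 1) .left), fun a S hS => ?_⟩
  have hb := hS.scratch
  have hb0 := hb b le_rfl
  have hb1 := hb (b + 1) (by omega)
  have ho := hS.out
  have r₁ := hp a S ⟨hS.var, hb0, fun r hr => hb r (by omega)⟩
  have r₂ := @RunsLE.loop A (str a) (.seq .right (.inc (b + 1))) b (x a) 2
    (fun i => update (update S b (x a - i)) (b + 1) i) (fun i => min i (str a).length)
    (fun i hi => by rw [update_of_ne (by omega), update_self])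
    (fun i hi => by
      have := ((Runs.right (s := str a) (S := update (update (update S b (x a - i)) (b + 1) i) b
        (x a - i - 1)) (h := min i (str a).length)).seq (Runs.inc (r := b + 1))).le
      convert this using 1
      · funext y
        simp only [update_apply]
        grind
      · split_ifs <;> omega)
  set S₁ : ℕ → ℕ := update S o (if (str a)[x a]?.any q then 1 else 0) with hS₁
  have r₃ := (Runs.test (s := str a) (S := update (update S b (x a - x a)) (b + 1) (x a))
    (h := min (x a) (str a).length) (q := q) (r := o)).le
  -- The head stops at the end of the word, where there is no letter, just as at every position
  -- beyond.
  have e₁ : (str a)[min (x a) (str a).length]? = (str a)[x a]? := by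
    rcases le_total (x a) (str a).length with h | h
    · rw [min_eq_left h]
    · rw [min_eq_right h, List.getElem?_eq_none le_rfl, List.getElem?_eq_none h]
  -- Going left `x a` times may exceed the distance covered, but the head then rests at `0`.
  have r₄ := @RunsLE.loop A (str a) .left (b + 1) (x a) 1
    (fun i => update S₁ (b + 1) (x a - i)) (fun i => min (x a) (str a).length - i)
    (fun i hi => by rw [update_self])
    (fun i hi => by
      have := (Runs.left (s := str a) (S := update (update S₁ (b + 1) (x a - i)) (b + 1)
        (x a - i - 1)) (h := min (x a) (str a).length - i)).le
      rw [update_idem] at this ⊢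
      exact this)
  have e₂ : update (update S b (x a - 0)) (b + 1) 0 = update S b (x a) := by
    funext y
    simp only [update_apply]
    grind
  have e₃ : (if (str a)[min (x a) (str a).length]?.any q = true then
      update (update (update S b (x a - x a)) (b + 1) (x a)) o
        (update (update S b (x a - x a)) (b + 1) (x a) o + 1)
      else update (update S b (x a - x a)) (b + 1) (x a)) = update S₁ (b + 1) (x a - 0) := by
    rw [e₁, hS₁]
    funext y
    split_ifs <;> simp only [update_apply] <;> grind
  have e₄ : update S₁ (b + 1) (x a - x a) = S₁ := by
    rw [hS₁]
    funext y
    simp only [update_apply]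
    grind
  have e₅ : min (x a) (str a).length - x a = 0 := by omega
  simp only [e₂, Nat.zero_min] at r₂
  rw [e₃] at r₃
  simp only [e₄, e₅, Nat.sub_zero] at r₃ r₄
  refine (((r₁.seq r₂).seq r₃).seq r₄).mono ?_
  have h₁ := hT a
  simp only [Polynomial.eval_add, Polynomial.eval_mul, Polynomial.eval_ofNat, Polynomial.eval_one]
  omega

/-- Register `b` is a flag: the loop consumes it, and the test restores it only if there is a letter
under the head. A round costs four steps; the round past the end, with the failing loop test, costs
five. -/
theorem runsLE_scan (s : List A) (S : ℕ → ℕ) {o b : ℕ} (hob : o ≠ b) :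
    ∀ k h, h + k = s.length → S b = 0 →
      RunsLE s (.loop b (.seq (.seq (.test (fun _ => true) b) (.test (fun _ => true) o)) .right))
        (update (update S b 1) o h) h (update S o s.length) s.length (k * 4 + 5) := by
  intro k
  induction k with
  | zero =>
    intro h hh hS
    have h' : s.length = h := by omega
    rw [h']
    have hn : s[h]? = none := List.getElem?_eq_none (by omega)
    have hr : Runs s (.seq (.seq (.test (fun _ => true) b) (.test (fun _ => true) o)) .right)
        (update (update (update S b 1) o h) b 0) h (update S o h) h (1 + 1 + 1) := by
      have h₁ := Runs.test (s := s) (S := update (update (update S b 1) o h) b 0) (h := h)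
        (q := fun _ => true) (r := b)
      have h₂ := Runs.test (s := s) (S := update (update (update S b 1) o h) b 0) (h := h)
        (q := fun _ => true) (r := o)
      have h₃ := Runs.right (s := s) (S := update (update (update S b 1) o h) b 0) (h := h)
      rw [hn, Option.any_none, if_neg (by simp)] at h₁ h₂
      rw [if_neg (by omega)] at h₃
      convert (h₁.seq h₂).seq h₃ using 1
      funext y
      simp only [update_apply]
      grind
    exact ⟨_, by omega, Runs.loop_succ (n := 0) (by rw [update_of_ne hob.symm, update_self]) hr
      (Runs.loop_zero (by rw [update_of_ne hob.symm, hS]))⟩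
  | succ k ih =>
    intro h hh hS
    obtain ⟨t, ht, hr'⟩ := ih (h + 1) (by omega) hS
    have hn : s[h]? = some s[h] := List.getElem?_eq_getElem (by omega)
    have hr : Runs s (.seq (.seq (.test (fun _ => true) b) (.test (fun _ => true) o)) .right)
        (update (update (update S b 1) o h) b 0) h (update (update S b 1) o (h + 1)) (h + 1)
        (1 + 1 + 1) := by
      have h₁ := Runs.test (s := s) (S := update (update (update S b 1) o h) b 0) (h := h)
        (q := fun _ => true) (r := b)
      have h₂ := fun S => Runs.test (s := s) (S := S) (h := h)
        (q := fun _ => true) (r := o)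
      have h₃ := fun S => Runs.right (s := s) (S := S) (h := h)
      simp only [hn, Option.any_some, if_true] at h₁ h₂
      simp only [show h < s.length by omega, if_true] at h₃
      convert (h₁.seq (h₂ _)).seq (h₃ _) using 1
      funext y
      simp only [update_apply]
      grind
    exact ⟨_, by omega, Runs.loop_succ (n := 0) (by rw [update_of_ne hob.symm, update_self]) hr hr'⟩

/-- After the scan the head stands at the end. The length found in `o` drives it back, while `b`
keeps a copy. -/
theorem PT.length : PT fun a : α => (str a).length := by
  refine ⟨1 + (Polynomial.X * 4 + 5) + (Polynomial.X * 3 + 1) + (Polynomial.X * 2 + 1),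
    fun a => ?_, fun loc o b hl => ?_⟩
  · have : (str a).length ≤ size a := Nat.le_add_right _ _
    simp
    omega
  have hob := hl.out_lt
  refine ⟨.seq (.seq (.seq (.inc b)
    (.loop b (.seq (.seq (.test (fun _ => true) b) (.test (fun _ => true) o)) .right)))
    (.loop o (.seq .left (.inc b)))) (.loop b (.inc o)), fun a S hS => ?_⟩
  have hb := hS.scratch b le_rfl
  have ho := hS.out
  have r₁ := (Runs.inc (s := str a) (S := S) (h := 0) (r := b)).le
  have r₂ := runsLE_scan (str a) S hob.ne (str a).length 0 (by omega) hb
  have r₃ := @RunsLE.loop A (str a) (.seq .left (.inc b)) o (str a).length 2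
    (fun i => update (update S o ((str a).length - i)) b i) (fun i => (str a).length - i)
    (fun i hi => by rw [update_of_ne hob.ne, update_self])
    (fun i hi => by
      have := ((Runs.left (s := str a) (S := update (update (update S o ((str a).length - i)) b i) o
        ((str a).length - i - 1)) (h := (str a).length - i)).seq (Runs.inc (r := b))).le
      convert this using 1
      · funext y
        simp only [update_apply]
        grind
      · omega)
  have r₄ := runsLE_move (str a) (update (update S o ((str a).length - (str a).length)) b
    (str a).length) 0 (r := b) (o := o) hob.ne'
  have e₁ : update S b (S b + 1) = update (update S b 1) o 0 := by
    funext y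
    simp only [update_apply]
    grind
  have e₂ : update (update S o (str a).length) b 0 = update S o (str a).length := by
    funext y
    simp only [update_apply]
    grind
  rw [e₁] at r₁
  simp only [Nat.sub_zero, Nat.sub_self, e₂] at r₃ r₄
  have r := ((r₁.seq r₂).seq r₃).seq r₄
  convert r.mono ?_ using 1
  · funext y
    simp only [update_apply]
    grind
  · have : (str a).length ≤ size a := Nat.le_add_right _ _
    rw [update_self]
    simp
    omega

end

/-- A decision problem is in P if the characteristic function of its yes-instances is computed
from the encoding in polynomial time. -/
theorem PT.inP [Inhabited A] [Fintype A] {I : Type} {enc : I → List A} {Yes : I → Prop}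
    {f : List A → ℕ} (hf : PT f) (h₀ : ∀ a, ¬ Yes a → f (enc a) = 0)
    (h₁ : ∀ a, Yes a → f (enc a) = 1) : InP enc Yes := by
  classical
  obtain ⟨T, -, hp⟩ := hf
  obtain ⟨p, hp⟩ := hp id 0 1 ⟨fun i hi => absurd hi (Nat.not_lt_zero i),
    fun i hi => absurd hi (Nat.not_lt_zero i), Nat.one_pos⟩
  refine inP_of_runs (fun a => decide (Yes a)) (fun a => by simp) p T fun a => ?_
  have := hp (enc a) (fun _ => 0) ⟨fun i hi => absurd hi (Nat.not_lt_zero i), rfl, fun _ _ => rfl⟩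
  have e : (decide (Yes a)).toNat = f (enc a) := by
    by_cases h : Yes a
    · simp [h, h₁ a h]
    · simp [h, h₀ a h]
  rw [e]
  exact this

end PossibleManipulators

namespace PossibleManipulators

open Function Finset Ctx

variable {A α : Type} [Ctx A α]

/-! ### Arithmetic and bounded quantifiers -/

theorem PT.exists_bound {f : α → ℕ} (hf : PT f) :
    ∃ T : Polynomial ℕ, ∀ a, f a ≤ T.eval (size a) :=
  let ⟨T, hT, _⟩ := hf
  ⟨T, hT⟩

theorem PT.of_eq {f g : α → ℕ} (hf : PT f) (h : ∀ a, f a = g a) : PT g :=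
  (funext h : f = g) ▸ hf

theorem PT.const (k : ℕ) : PT fun _ : α => k := by
  induction k with
  | zero => exact PT.zero
  | succ k ih => exact ih.succ

theorem PT.add {x y : α → ℕ} (hx : PT x) (hy : PT y) : PT fun a => x a + y a := by
  obtain ⟨Tx, hTx⟩ := hx.exists_bound
  obtain ⟨Ty, hTy⟩ := hy.exists_bound
  refine PT.prec (f := fun a i => x a + i) (h := fun p => p.2 + 1) hx PT.last.succ hy
    (fun a => rfl) (fun a i => rfl) (Tx + Ty) fun a i hi => ?_
  have h₁ := hTx a
  have h₂ := hTy a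
  rw [Polynomial.eval_add]
  omega

/-- Products, bounded quantifiers, halving and the search for positions in the word are all
expressed through this sum. -/
theorem PT.sum {n : α → ℕ} {g : α → ℕ → ℕ} (hn : PT n) (hg : PT fun p : α × ℕ => g p.1 p.2) :
    PT fun a => ∑ i ∈ range (n a), g a i := by
  obtain ⟨Tn, hTn⟩ := hn.exists_bound
  obtain ⟨Tg, hTg⟩ := hg.exists_bound
  refine PT.prec (f := fun a i => ∑ k ∈ range i, g a k) (h := fun p => p.2 + g p.1.1 p.1.2)
    PT.zero (PT.last.add hg.weaken) hn (fun a => by simp)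
    (fun a i => Finset.sum_range_succ _ _) (Tn * Tg.comp (Polynomial.X + Tn)) fun a i hi => ?_
  have h₁ := hTn a
  calc ∑ k ∈ range i, g a k ≤ ∑ k ∈ range i, (Tg.comp (Polynomial.X + Tn)).eval (size a) := by
        refine Finset.sum_le_sum fun k hk => (hTg (a, k)).trans ?_
        have := Finset.mem_range.1 hk
        rw [Polynomial.eval_comp, size_prod]
        apply Polynomial.eval_monotone_nat Tg
        simp only [Polynomial.eval_add, Polynomial.eval_X]
        omega
    _ = i * (Tg.comp (Polynomial.X + Tn)).eval (size a) := by simp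
    _ ≤ _ := by
        rw [Polynomial.eval_mul]
        exact Nat.mul_le_mul_right _ (hi.trans h₁)

theorem PT.mul {x y : α → ℕ} (hx : PT x) (hy : PT y) : PT fun a => x a * y a :=
  (PT.sum hx (g := fun a _ => y a) hy.weaken).of_eq fun a => by simp

/-- The recursion ignores the accumulated value: its step just returns the index of the round. -/
theorem PT.pred {x : α → ℕ} (hx : PT x) : PT fun a => x a - 1 := by
  obtain ⟨T, hT⟩ := hx.exists_bound
  exact PT.prec (f := fun a i => i - 1) (h := fun p => p.1.2) PT.zero PT.last.weaken hx
    (fun a => rfl) (fun a i => rfl) T fun a i hi => ((Nat.sub_le i 1).trans hi).trans (hT a)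

theorem PT.sub {x y : α → ℕ} (hx : PT x) (hy : PT y) : PT fun a => x a - y a := by
  obtain ⟨T, hT⟩ := hx.exists_bound
  exact PT.prec (f := fun a i => x a - i) (h := fun p => p.2 - 1) hx PT.last.pred hy
    (fun a => rfl) (fun a i => rfl) T fun a i hi => (Nat.sub_le _ i).trans (hT a)

open Classical in
/-- The truth value of `P` as a number. -/
noncomputable def ind (P : Prop) : ℕ := if P then 1 else 0

theorem ind_of {P : Prop} (h : P) : ind P = 1 := if_pos h

theorem ind_of_not {P : Prop} (h : ¬ P) : ind P = 0 := if_neg h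

theorem ind_le_one (P : Prop) : ind P ≤ 1 := by
  unfold ind
  split_ifs <;> simp

theorem ind_congr {P Q : Prop} (h : P ↔ Q) : ind P = ind Q := by rw [propext h]

/-- The characteristic function of the predicate `P` is computable in polynomial time. -/
def PTPred (P : α → Prop) : Prop := PT fun a => ind (P a)

theorem PTPred.of_iff {P Q : α → Prop} (hP : PTPred P) (h : ∀ a, P a ↔ Q a) : PTPred Q :=
  PT.of_eq hP fun a => ind_congr (h a)

theorem PTPred.weaken {P : α → Prop} (hP : PTPred P) : PTPred fun p : α × ℕ => P p.1 :=
  PT.weaken hP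

theorem PTPred.le {x y : α → ℕ} (hx : PT x) (hy : PT y) : PTPred fun a => x a ≤ y a :=
  ((PT.const 1).sub (hx.sub hy)).of_eq fun a => by
    by_cases h : x a ≤ y a
    · rw [ind_of h]; omega
    · rw [ind_of_not h]; omega

theorem PTPred.lt {x y : α → ℕ} (hx : PT x) (hy : PT y) : PTPred fun a => x a < y a :=
  PTPred.le hx.succ hy

theorem PTPred.not {P : α → Prop} (hP : PTPred P) : PTPred fun a => ¬ P a :=
  ((PT.const 1).sub hP).of_eq fun a => by
    by_cases h : P a
    · rw [ind_of h, ind_of_not (not_not.2 h)]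
    · rw [ind_of h, ind_of_not h]

theorem PTPred.and {P Q : α → Prop} (hP : PTPred P) (hQ : PTPred Q) :
    PTPred fun a => P a ∧ Q a :=
  (PT.mul hP hQ).of_eq fun a => by
    by_cases h₁ : P a
    · by_cases h₂ : Q a
      · rw [ind_of h₁, ind_of h₂, ind_of ⟨h₁, h₂⟩]
      · rw [ind_of_not h₂, ind_of_not (P := P a ∧ Q a) fun h => h₂ h.2, mul_zero]
    · rw [ind_of_not h₁, ind_of_not (P := P a ∧ Q a) fun h => h₁ h.1, zero_mul]

theorem PTPred.or {P Q : α → Prop} (hP : PTPred P) (hQ : PTPred Q) :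
    PTPred fun a => P a ∨ Q a :=
  (hP.not.and hQ.not).not.of_iff fun a => by tauto

theorem PTPred.imp {P Q : α → Prop} (hP : PTPred P) (hQ : PTPred Q) :
    PTPred fun a => P a → Q a :=
  (hP.not.or hQ).of_iff fun a => by tauto

theorem PTPred.iff {P Q : α → Prop} (hP : PTPred P) (hQ : PTPred Q) :
    PTPred fun a => (P a ↔ Q a) :=
  ((hP.imp hQ).and (hQ.imp hP)).of_iff fun a => by tauto

theorem PTPred.eq {x y : α → ℕ} (hx : PT x) (hy : PT y) : PTPred fun a => x a = y a :=
  ((PTPred.le hx hy).and (PTPred.le hy hx)).of_iff fun a => by omega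

theorem PTPred.ex {n : α → ℕ} {P : α → ℕ → Prop} (hn : PT n)
    (hP : PTPred fun p : α × ℕ => P p.1 p.2) : PTPred fun a => ∃ i < n a, P a i := by
  refine (PTPred.le (PT.const 1) (PT.sum hn (g := fun a i => ind (P a i)) hP)).of_iff fun a => ?_
  constructor
  · intro h
    obtain ⟨i, hi, h⟩ := Finset.exists_ne_zero_of_sum_ne_zero (Nat.one_le_iff_ne_zero.1 h)
    exact ⟨i, Finset.mem_range.1 hi, by_contra fun h' => h (ind_of_not h')⟩
  · rintro ⟨i, hi, h⟩
    rw [← ind_of h]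
    exact Finset.single_le_sum (f := fun i => ind (P a i)) (fun _ _ => Nat.zero_le _)
      (Finset.mem_range.2 hi)

theorem PTPred.all {n : α → ℕ} {P : α → ℕ → Prop} (hn : PT n)
    (hP : PTPred fun p : α × ℕ => P p.1 p.2) : PTPred fun a => ∀ i < n a, P a i :=
  (PTPred.ex hn (P := fun a i => ¬ P a i) hP.not).not.of_iff fun a => by push Not; rfl

/-- The half is the number of `i` with `2 * (i + 1) ≤ x`. -/
theorem PT.half {x : α → ℕ} (hx : PT x) : PT fun a => x a / 2 := by
  refine (PT.sum hx (g := fun a i => ind (i + i + 2 ≤ x a))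
    (PTPred.le ((PT.last.add PT.last).add (PT.const 2)) hx.weaken)).of_eq fun a => ?_
  have h : ∀ n k : ℕ, ∑ i ∈ range n, ind (i + i + 2 ≤ k) = min n (k / 2) := by
    intro n k
    induction n with
    | zero => simp
    | succ n ih =>
      rw [Finset.sum_range_succ, ih]
      by_cases h : n + n + 2 ≤ k
      · rw [ind_of h]; omega
      · rw [ind_of_not h]; omega
  rw [h]
  omega

theorem PT.ite {P : α → Prop} [∀ a, Decidable (P a)] {x y : α → ℕ} (hP : PTPred P) (hx : PT x)
    (hy : PT y) : PT fun a => if P a then x a else y a :=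
  ((PT.mul hP hx).add (PT.mul hP.not hy)).of_eq fun a => by
    by_cases h : P a
    · rw [ind_of h, ind_of_not (not_not.2 h), if_pos h]; omega
    · rw [ind_of_not h, ind_of h, if_neg h]; omega

theorem PTPred.letter [DecidableEq A] {x : α → ℕ} (hx : PT x) (l : A) :
    PTPred fun a => (str a)[x a]? = some l :=
  (hx.letter fun l' => decide (l' = l)).of_eq fun a => by
    unfold ind
    congr 1
    rcases h : (str a)[x a]? with _ | l' <;> simp [h]

end PossibleManipulators

namespace PossibleManipulators

open Function Finset Ctx

/-! ### The decision procedure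

All quantities are read off from the encoding `s`. Numbers in `s` are addressed by their index
among all numbers of `s`, and a candidate is addressed by its position in the tie-breaking order. -/

instance : Inhabited Letter := ⟨.minus⟩

/-- The number of occurrences of the letter `l` among the first `i` letters. -/
noncomputable def occ (s : List Letter) (l : Letter) (i : ℕ) : ℕ :=
  ∑ k ∈ range i, ind (s[k]? = some l)

/-- The position of the occurrence number `t` of the letter `l`. -/
noncomputable def occPos (s : List Letter) (l : Letter) (t : ℕ) : ℕ :=
  ∑ i ∈ range s.length, ind (occ s l (i + 1) ≤ t)

/-- The letter at position `k` is a binary digit. -/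
def IsDigit (s : List Letter) (k : ℕ) : Prop :=
  s[k]? = some (.bit true) ∨ s[k]? = some (.bit false)

/-- The position of the first digit of the number with index `t`. -/
noncomputable def numStart (s : List Letter) (t : ℕ) : ℕ :=
  ∑ i ∈ range (occPos s .endNum t), ind (∃ k < occPos s .endNum t, i ≤ k ∧ ¬ IsDigit s k)

/-- The binary digit `j` of the number with index `t` is one. -/
def NumBit (s : List Letter) (t j : ℕ) : Prop :=
  numStart s t + j < occPos s .endNum t ∧ s[numStart s t + j]? = some (.bit true)

/-- The number with index `t` is negative. -/
def NumNeg (s : List Letter) (t : ℕ) : Prop :=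
  0 < numStart s t ∧ s[numStart s t - 1]? = some .minus

/-- The numbers with indices `t` and `u` have the same absolute value. -/
def NumEq (s : List Letter) (t u : ℕ) : Prop :=
  ∀ j < s.length, (NumBit s t j ↔ NumBit s u j)

/-- The number of candidates. -/
noncomputable def candCount (s : List Letter) : ℕ :=
  (∑ i ∈ range s.length, ind (s[i]? = some .endNum ∧ occ s .endBlock i = 0)) - 1

/-- The index of the number that names the candidate `a`. -/
noncomputable def candIdx (s : List Letter) (a : ℕ) : ℕ := 1 + candCount s + a

/-- The index of the number that names the candidate at position `i` in the vote `w`. -/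
noncomputable def voteIdx (s : List Letter) (w i : ℕ) : ℕ :=
  1 + candCount s + candCount s * (w + 1) + i

/-- The position of the candidate `a` in the vote `w`. -/
noncomputable def votePos (s : List Letter) (w a : ℕ) : ℕ :=
  ∑ i ∈ range (candCount s), i * ind (NumEq s (voteIdx s w i) (candIdx s a))

/-- The index of the score of the candidate `a` in the vote `w`, provided the vote `v` has been
changed so that it places `a` at position `i`. -/
noncomputable def scoreIdx (s : List Letter) (v a i w : ℕ) : ℕ :=
  1 + if w = v then i else votePos s w a

/-- The number of ones among the binary digits `j` of the positive scores of `a` and of the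
negative scores of `b`. -/
noncomputable def column (s : List Letter) (n v a i b p j : ℕ) : ℕ :=
  ∑ w ∈ range n, (ind (NumBit s (scoreIdx s v a i w) j ∧ ¬ NumNeg s (scoreIdx s v a i w)) +
    ind (NumBit s (scoreIdx s v b p w) j ∧ NumNeg s (scoreIdx s v b p w)))

/-- The carry, shifted by `2 * n`, before digit `j` in the subtraction of the score of `b` from
the score of `a`. -/
noncomputable def carry (s : List Letter) (n v a i b p : ℕ) : ℕ → ℕ
  | 0 => 2 * n
  | j + 1 => (carry s n v a i b p j + 2 * n + column s n v a i b p j - column s n v b p a i j) / 2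

/-- The score of `a` is less than the score of `b`, provided the vote `v` has been changed so that
it places `a` at position `i` and `b` at position `p`. -/
def ScoreLT (s : List Letter) (n v a i b p : ℕ) : Prop := carry s n v a i b p s.length < 2 * n

/-- The candidate `b` is ahead of the candidate `a`, provided the vote `v` has been changed so that
it places `b` at position `p` and `a` at position `i`. -/
def Ahead (s : List Letter) (n v b p a i : ℕ) : Prop :=
  (a < b → ScoreLT s n v a i b p) ∧ (b ≤ a → ¬ ScoreLT s n v b p a i)

/-- The candidate `x` wins if no vote is changed. -/
def Wins (s : List Letter) (n x : ℕ) : Prop :=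
  ∀ c < candCount s, c ≠ x → Ahead s n n x 0 c 0

/-- The vote `v` can be changed so that it places `y` at position `p` and `x` at position `q`, and
so that all candidates but `x` stay behind `y`. -/
def Placeable (s : List Letter) (n v x y p q : ℕ) : Prop :=
  ∀ i < candCount s, i + 1 ≤
    (∑ c ∈ range (candCount s), ind (c ≠ x ∧ c ≠ y ∧ Ahead s n v y p c i)) +
      ind (p ≤ i) + ind (q ≤ i)

/-- The voter `v` is a possible manipulator against `y`. -/
def Suspect (s : List Letter) (n v y : ℕ) : Prop :=
  ∃ x < candCount s, Wins s n x ∧ x ≠ y ∧ ∃ p < candCount s, ∃ q < p,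
    Ahead s n v y p x q ∧ Placeable s n v x y p q

/-- The voter `v` belongs to the given coalition. -/
def Member (s : List Letter) (n v : ℕ) : Prop :=
  s[occPos s .endBlock (n + 2) + 1 + v]? = some (.bit true)

/-- The candidate `a` is the given actual winner. -/
def IsGiven (s : List Letter) (n a : ℕ) : Prop :=
  NumEq s (candIdx s a) (1 + candCount s + candCount s * (n + 1))

/-- The number of voters, if the encoding contains `k` blocks that are not votes. -/
noncomputable def voterCount (k : ℕ) (s : List Letter) : ℕ := occ s .endBlock s.length - k

/-! ### The decision procedure runs in polynomial time. -/

section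

variable {α : Type} [Ctx Letter α] {n v a b i j p q t u w x y : α → ℕ}

theorem PT.occ (l : Letter) (hi : PT i) : PT fun c => occ (str c) l (i c) :=
  PT.sum hi (PTPred.letter PT.last l)

theorem PT.occPos (l : Letter) (ht : PT t) : PT fun c => occPos (str c) l (t c) :=
  PT.sum PT.length (PTPred.le (PT.occ l PT.last.succ) ht.weaken)

theorem PTPred.isDigit (hi : PT i) : PTPred fun c => IsDigit (str c) (i c) :=
  (PTPred.letter hi _).or (PTPred.letter hi _)

theorem PT.numStart (ht : PT t) : PT fun c => numStart (str c) (t c) :=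
  PT.sum (PT.occPos _ ht) (PTPred.ex (PT.occPos _ ht).weaken
    ((PTPred.le PT.last.weaken PT.last).and (PTPred.isDigit PT.last).not))

theorem PTPred.numBit (ht : PT t) (hj : PT j) : PTPred fun c => NumBit (str c) (t c) (j c) :=
  (PTPred.lt ((PT.numStart ht).add hj) (PT.occPos _ ht)).and
    (PTPred.letter ((PT.numStart ht).add hj) _)

theorem PTPred.numNeg (ht : PT t) : PTPred fun c => NumNeg (str c) (t c) :=
  (PTPred.lt PT.zero (PT.numStart ht)).and (PTPred.letter (PT.numStart ht).pred _)

theorem PTPred.numEq (ht : PT t) (hu : PT u) : PTPred fun c => NumEq (str c) (t c) (u c) :=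
  PTPred.all PT.length ((PTPred.numBit ht.weaken PT.last).iff (PTPred.numBit hu.weaken PT.last))

theorem PT.candCount : PT fun c : α => candCount (str c) :=
  (PT.sum PT.length (g := fun c i => ind ((str c)[i]? = some Letter.endNum ∧
    PossibleManipulators.occ (str c) .endBlock i = 0)) ((PTPred.letter PT.last _).and
    (PTPred.eq (PT.occ _ PT.last) PT.zero))).pred

theorem PT.candIdx (ha : PT a) : PT fun c => candIdx (str c) (a c) :=
  ((PT.const 1).add PT.candCount).add ha

theorem PT.voteIdx (hw : PT w) (hi : PT i) : PT fun c => voteIdx (str c) (w c) (i c) :=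
  (((PT.const 1).add PT.candCount).add (PT.candCount.mul hw.succ)).add hi

theorem PT.votePos (hw : PT w) (ha : PT a) : PT fun c => votePos (str c) (w c) (a c) :=
  PT.sum PT.candCount (PT.last.mul
    (PTPred.numEq (PT.voteIdx hw.weaken PT.last) (PT.candIdx ha.weaken)))

theorem PT.scoreIdx (hv : PT v) (ha : PT a) (hi : PT i) (hw : PT w) :
    PT fun c => scoreIdx (str c) (v c) (a c) (i c) (w c) :=
  (PT.const 1).add (PT.ite (PTPred.eq hw hv) hi (PT.votePos hw ha))

theorem PT.column (hn : PT n) (hv : PT v) (ha : PT a) (hi : PT i) (hb : PT b) (hp : PT p)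
    (hj : PT j) : PT fun c => column (str c) (n c) (v c) (a c) (i c) (b c) (p c) (j c) :=
  have h₁ := PT.scoreIdx hv.weaken ha.weaken hi.weaken PT.last
  have h₂ := PT.scoreIdx hv.weaken hb.weaken hp.weaken PT.last
  PT.sum hn (PT.add ((PTPred.numBit h₁ hj.weaken).and (PTPred.numNeg h₁).not)
    ((PTPred.numBit h₂ hj.weaken).and (PTPred.numNeg h₂)))

theorem column_le (s : List Letter) (n v a i b p j : ℕ) : column s n v a i b p j ≤ 2 * n := by
  have : column s n v a i b p j ≤ ∑ w ∈ range n, 2 :=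
    Finset.sum_le_sum fun w _ => add_le_add (ind_le_one _) (ind_le_one _)
  simpa [mul_comm] using this

/-- The bound reproduces itself, as `(4 * n + 2 * n + 2 * n) / 2 = 4 * n`. It does not depend on the
size of the scores, which lets `PT.prec` apply to the carry. -/
theorem carry_le (s : List Letter) (n v a i b p j : ℕ) : carry s n v a i b p j ≤ 4 * n := by
  induction j with
  | zero => rw [carry]; omega
  | succ j ih =>
    rw [carry]
    have := column_le s n v a i b p j
    omega

theorem PT.carry (hn : PT n) (hv : PT v) (ha : PT a) (hi : PT i) (hb : PT b) (hp : PT p)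
    (hj : PT j) : PT fun c => carry (str c) (n c) (v c) (a c) (i c) (b c) (p c) (j c) := by
  obtain ⟨T, hT⟩ := hn.exists_bound
  have h2 := (PT.const 2).mul hn
  refine PT.prec (f := fun c j => PossibleManipulators.carry (str c) (n c) (v c) (a c) (i c) (b c)
    (p c) j) (h := fun x => (x.2 + 2 * n x.1.1 +
      PossibleManipulators.column (str x.1.1) (n x.1.1) (v x.1.1) (a x.1.1) (i x.1.1) (b x.1.1)
        (p x.1.1) x.1.2 -
      PossibleManipulators.column (str x.1.1) (n x.1.1) (v x.1.1) (b x.1.1) (p x.1.1) (a x.1.1)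
        (i x.1.1) x.1.2) / 2) h2 ?_ hj (fun c => rfl) (fun c j => rfl) (4 * T) fun c j _ => ?_
  · exact (((PT.last.add h2.weaken.weaken).add
      (PT.column hn.weaken hv.weaken ha.weaken hi.weaken hb.weaken hp.weaken PT.last).weaken).sub
      (PT.column hn.weaken hv.weaken hb.weaken hp.weaken ha.weaken hi.weaken PT.last).weaken).half
  · have := carry_le (str c) (n c) (v c) (a c) (i c) (b c) (p c) j
    have := hT c
    simp only [Polynomial.eval_mul, Polynomial.eval_ofNat]
    omega

theorem PTPred.scoreLT (hn : PT n) (hv : PT v) (ha : PT a) (hi : PT i) (hb : PT b) (hp : PT p) :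
    PTPred fun c => ScoreLT (str c) (n c) (v c) (a c) (i c) (b c) (p c) :=
  PTPred.lt (PT.carry hn hv ha hi hb hp PT.length) ((PT.const 2).mul hn)

theorem PTPred.ahead (hn : PT n) (hv : PT v) (hb : PT b) (hp : PT p) (ha : PT a) (hi : PT i) :
    PTPred fun c => Ahead (str c) (n c) (v c) (b c) (p c) (a c) (i c) :=
  ((PTPred.lt ha hb).imp (PTPred.scoreLT hn hv ha hi hb hp)).and
    ((PTPred.le hb ha).imp (PTPred.scoreLT hn hv hb hp ha hi).not)

theorem PTPred.wins (hn : PT n) (hx : PT x) : PTPred fun c => Wins (str c) (n c) (x c) :=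
  PTPred.all PT.candCount ((PTPred.eq PT.last hx.weaken).not.imp
    (PTPred.ahead hn.weaken hn.weaken hx.weaken PT.zero PT.last PT.zero))

theorem PTPred.placeable (hn : PT n) (hv : PT v) (hx : PT x) (hy : PT y) (hp : PT p) (hq : PT q) :
    PTPred fun c => Placeable (str c) (n c) (v c) (x c) (y c) (p c) (q c) :=
  PTPred.all PT.candCount (PTPred.le PT.last.succ
    (PT.add (PT.add (PT.sum PT.candCount
      ((PTPred.eq PT.last hx.weaken.weaken).not.and ((PTPred.eq PT.last hy.weaken.weaken).not.and
        (PTPred.ahead hn.weaken.weaken hv.weaken.weaken hy.weaken.weaken hp.weaken.weaken PT.last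
          PT.last.weaken))))
      (PTPred.le hp.weaken PT.last)) (PTPred.le hq.weaken PT.last)))

theorem PTPred.suspect (hn : PT n) (hv : PT v) (hy : PT y) :
    PTPred fun c => Suspect (str c) (n c) (v c) (y c) := by
  refine PTPred.ex PT.candCount ((PTPred.wins hn.weaken PT.last).and
    ((PTPred.eq PT.last hy.weaken).not.and (PTPred.ex PT.candCount (PTPred.ex PT.last ?_))))
  -- Three bound variables surround the innermost formula: `x`, `p` and `q`, from the outermost in.
  have hn' := hn.weaken.weaken.weaken
  have hv' := hv.weaken.weaken.weaken
  have hy' := hy.weaken.weaken.weaken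
  exact (PTPred.ahead hn' hv' hy' PT.last.weaken PT.last.weaken.weaken PT.last).and
    (PTPred.placeable hn' hv' PT.last.weaken.weaken hy' PT.last.weaken PT.last)

theorem PTPred.member (hn : PT n) (hv : PT v) : PTPred fun c => Member (str c) (n c) (v c) :=
  PTPred.letter (((PT.occPos _ (hn.add (PT.const 2))).add (PT.const 1)).add hv) _

theorem PTPred.isGiven (hn : PT n) (ha : PT a) : PTPred fun c => IsGiven (str c) (n c) (a c) :=
  PTPred.numEq (PT.candIdx ha) (((PT.const 1).add PT.candCount).add (PT.candCount.mul hn.succ))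

theorem PT.voterCount (k : ℕ) : PT fun c : α => voterCount k (str c) :=
  (PT.occ _ PT.length).sub (PT.const k)

end

/-! ### The procedures for the four problems. -/

/-- The decision procedure for `CPMW` with a single suspect. -/
def DecideCPMW (s : List Letter) : Prop :=
  ∃ v < voterCount 4 s, Member s (voterCount 4 s) v ∧
    ∃ y < candCount s, IsGiven s (voterCount 4 s) y ∧ Suspect s (voterCount 4 s) v y

/-- The decision procedure for `CPM` with a single suspect. -/
def DecideCPM (s : List Letter) : Prop :=
  ∃ v < voterCount 4 s, Member s (voterCount 4 s) v ∧
    ∃ y < candCount s, Suspect s (voterCount 4 s) v y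

/-- The decision procedure for `CPMSW` with coalitions of size at most one. -/
def DecideCPMSW (s : List Letter) : Prop :=
  ∃ v < voterCount 3 s, ∃ y < candCount s, IsGiven s (voterCount 3 s) y ∧
    Suspect s (voterCount 3 s) v y

/-- The decision procedure for `CPMS` with coalitions of size at most one. -/
def DecideCPMS (s : List Letter) : Prop :=
  ∃ v < voterCount 3 s, ∃ y < candCount s, Suspect s (voterCount 3 s) v y

theorem PTPred.decideCPMW : PTPred DecideCPMW :=
  PTPred.ex (PT.voterCount _) ((PTPred.member (PT.voterCount _) PT.last).and (PTPred.ex PT.candCount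
    ((PTPred.isGiven (PT.voterCount _) PT.last).and
      (PTPred.suspect (PT.voterCount _) PT.last.weaken PT.last))))

theorem PTPred.decideCPM : PTPred DecideCPM :=
  PTPred.ex (PT.voterCount _) ((PTPred.member (PT.voterCount _) PT.last).and (PTPred.ex PT.candCount
    (PTPred.suspect (PT.voterCount _) PT.last.weaken PT.last)))

theorem PTPred.decideCPMSW : PTPred DecideCPMSW :=
  PTPred.ex (PT.voterCount _) (PTPred.ex PT.candCount
    ((PTPred.isGiven (PT.voterCount _) PT.last).and
      (PTPred.suspect (PT.voterCount _) PT.last.weaken PT.last)))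

theorem PTPred.decideCPMS : PTPred DecideCPMS :=
  PTPred.ex (PT.voterCount _) (PTPred.ex PT.candCount
    (PTPred.suspect (PT.voterCount _) PT.last.weaken PT.last))

theorem PTPred.inP {I : Type} {enc : I → List Letter} {Yes : I → Prop} {P : List Letter → Prop}
    (hP : PTPred P) (h : ∀ a, P (enc a) ↔ Yes a) : InP enc Yes :=
  PT.inP hP (fun a ha => ind_of_not (mt (h a).1 ha)) (fun a ha => ind_of ((h a).2 ha))

end PossibleManipulators

namespace PossibleManipulators

open Function Finset

/-! ### Reading the encoding -/

/-- Positions in the word are defined by counting the indices before them; this evaluates such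
counts. -/
theorem sum_ind_lt {N k : ℕ} (hk : k ≤ N) {Q : ℕ → Prop} (hQ : ∀ i < N, (Q i ↔ i < k)) :
    ∑ i ∈ range N, ind (Q i) = k := by
  have h₁ : ∑ i ∈ range k, ind (Q i) = ∑ i ∈ range N, ind (Q i) := by
    refine Finset.sum_subset (Finset.range_subset_range.2 hk) fun i hi hi' => ind_of_not ?_
    rw [hQ i (Finset.mem_range.1 hi)]
    simpa using hi'
  rw [← h₁, Finset.sum_congr rfl fun i hi => ind_of ((hQ i ((Finset.mem_range.1 hi).trans_le hk)).2
    (Finset.mem_range.1 hi))]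
  simp

theorem occ_eq_count (s : List Letter) (l : Letter) (i : ℕ) : occ s l i = (s.take i).count l := by
  induction i with
  | zero => simp [occ]
  | succ i ih =>
    have h : occ s l (i + 1) = occ s l i + ind (s[i]? = some l) := Finset.sum_range_succ _ _
    rw [h, ih, List.take_add_one, List.count_append]
    congr 1
    rcases h : s[i]? with _ | x
    · simp [ind]
    · by_cases hx : x = l <;> simp [ind, hx]

/-- A prefix of length `i + 1` contains at most `t` occurrences exactly when it ends before the
occurrence that follows `P`. -/
theorem occPos_eq {s P B : List Letter} {l : Letter} {t : ℕ} (hs : s = P ++ l :: B)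
    (ht : P.count l = t) : occPos s l t = P.length := by
  subst hs
  refine sum_ind_lt (by simp) fun i hi => ?_
  rw [occ_eq_count]
  constructor
  · intro h
    by_contra hi'
    have h₁ : ((P ++ l :: B).take (P.length + 1)).Sublist ((P ++ l :: B).take (i + 1)) :=
      (List.take_prefix_take_left (by omega)).sublist
    have h₂ := h₁.count_le l
    have h₃ : (P ++ l :: B).take (P.length + 1) = P ++ [l] := by
      rw [List.take_append]
      simp
    rw [h₃, List.count_append, List.count_singleton_self] at h₂
    omega
  · intro h
    rw [List.take_append_of_le_length (by omega), ← ht]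
    exact (List.take_sublist _ _).count_le l

/-- The word `A` does not end within a number. -/
def Boundary (A : List Letter) : Prop := ∀ x ∈ A.getLast?, x = .endNum ∨ x = .endBlock

theorem Boundary.nil : Boundary [] := by simp [Boundary]

theorem Boundary.append {A B : List Letter} (hA : Boundary A) (hB : Boundary B) :
    Boundary (A ++ B) := by
  intro x hx
  rw [List.getLast?_append] at hx
  rcases h : B.getLast? with _ | y
  · rw [h] at hx
    exact hA x (by simpa using hx)
  · rw [h] at hx
    exact hB x (by simpa [h] using hx)

theorem Boundary.flatMap {β : Type} {g : β → List Letter} (hg : ∀ x, Boundary (g x))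
    (L : List β) : Boundary (L.flatMap g) := by
  induction L with
  | nil => exact Boundary.nil
  | cons x L ih => exact (hg x).append ih

theorem boundary_concat_endNum (A : List Letter) : Boundary (A ++ [.endNum]) := by
  simp [Boundary]

theorem boundary_concat_endBlock (A : List Letter) : Boundary (A ++ [.endBlock]) := by
  simp [Boundary]

/-- The encoding starts with the least significant digit, in agreement with `testBit`. -/
theorem encodePosNum_getElem? (p : PosNum) (j : ℕ) :
    (Computability.encodePosNum p)[j]? = some true ↔ (p : ℕ).testBit j = true := by
  induction p generalizing j with
  | one => cases j <;> simp [Computability.encodePosNum, Nat.testBit_succ]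
  | bit0 p ih =>
    cases j with
    | zero => simp [Computability.encodePosNum]; omega
    | succ j =>
      simp only [Computability.encodePosNum, List.getElem?_cons_succ, ih, PosNum.cast_bit0,
        Nat.testBit_succ]
      rw [show ((p : ℕ) + p) / 2 = p by omega]
  | bit1 p ih =>
    cases j with
    | zero => simp [Computability.encodePosNum]; omega
    | succ j =>
      simp only [Computability.encodePosNum, List.getElem?_cons_succ, ih, PosNum.cast_bit1,
        Nat.testBit_succ]
      rw [show ((p : ℕ) + p + 1) / 2 = p by omega]

theorem encodeNat_getElem? (k j : ℕ) :
    (Computability.encodeNat k)[j]? = some true ↔ k.testBit j = true := by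
  have h : ((k : Num) : ℕ) = k := Num.to_of_nat k
  unfold Computability.encodeNat
  rcases hk : (k : Num) with _ | p
  · rw [hk] at h
    simp only [Computability.encodeNum]
    have : k = 0 := by rw [← h]; rfl
    simp [this]
  · rw [hk] at h
    simp only [Computability.encodeNum]
    rw [encodePosNum_getElem?, ← h]
    rfl

theorem isDigit_iff {s : List Letter} {k : ℕ} : IsDigit s k ↔ ∃ b, s[k]? = some (.bit b) := by
  simp [IsDigit, or_comm]

section

variable {s A B : List Letter} {d : List Bool} {t : ℕ}

theorem occPos_endNum (hs : s = A ++ (d.map Letter.bit ++ .endNum :: B))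
    (ht : A.count .endNum = t) : occPos s .endNum t = A.length + d.length := by
  rw [occPos_eq (P := A ++ d.map Letter.bit) (B := B) (by simp [hs]), List.length_append,
    List.length_map]
  rw [List.count_append, ht, List.count_eq_zero_of_not_mem (by simp), add_zero]

theorem getElem?_digits (hs : s = A ++ (d.map Letter.bit ++ .endNum :: B)) {j : ℕ}
    (hj : j < d.length) : s[A.length + j]? = some (.bit d[j]) := by
  subst hs
  rw [List.getElem?_append_right (by omega), Nat.add_sub_cancel_left,
    List.getElem?_append_left (by simpa using hj)]
  simp [hj]

/-- By `hA` the prefix does not end in a digit, so exactly the positions inside `A` have a non-digit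
between themselves and the end mark. -/
theorem numStart_eq (hs : s = A ++ (d.map Letter.bit ++ .endNum :: B))
    (ht : A.count .endNum = t) (hA : ∀ b, A.getLast? ≠ some (.bit b)) :
    numStart s t = A.length := by
  unfold numStart
  rw [occPos_endNum hs ht]
  refine sum_ind_lt (Nat.le_add_right _ _) fun i hi => ?_
  constructor
  · rintro ⟨k, hk, hik, hd⟩
    by_contra hi'
    refine hd (isDigit_iff.2 ⟨d[k - A.length]'(by omega), ?_⟩)
    rw [← getElem?_digits hs, show A.length + (k - A.length) = k by omega]
  · intro h
    refine ⟨A.length - 1, by omega, by omega, fun hd => ?_⟩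
    obtain ⟨b, hb⟩ := isDigit_iff.1 hd
    rw [hs, List.getElem?_append_left (by omega), ← List.getLast?_eq_getElem?] at hb
    exact hA b hb

theorem numBit_iff (hs : s = A ++ (d.map Letter.bit ++ .endNum :: B))
    (ht : A.count .endNum = t) (hA : ∀ b, A.getLast? ≠ some (.bit b)) (j : ℕ) :
    NumBit s t j ↔ d[j]? = some true := by
  unfold NumBit
  rw [occPos_endNum hs ht, numStart_eq hs ht hA, Nat.add_lt_add_iff_left]
  constructor
  · rintro ⟨h₁, h₂⟩
    rw [getElem?_digits hs h₁] at h₂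
    rw [List.getElem?_eq_getElem h₁]
    simpa using h₂
  · intro h
    obtain ⟨h₁, h₂⟩ := List.getElem?_eq_some_iff.1 h
    exact ⟨h₁, by rw [getElem?_digits hs h₁, h₂]⟩

end

/-! ### Signed numbers in the word. -/

/-- The number with index `t` in the word `s` is `z`. -/
def HasNum (s : List Letter) (t : ℕ) (z : ℤ) : Prop :=
  ∃ A B, s = A ++ (encInt z ++ B) ∧ A.count .endNum = t ∧ Boundary A

theorem Boundary.getLast?_ne_bit {A : List Letter} (hA : Boundary A) (b : Bool) :
    A.getLast? ≠ some (.bit b) := fun h => by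
  simpa using hA (.bit b) h

theorem encInt_of_nonneg {z : ℤ} (hz : 0 ≤ z) : encInt z = encNat z.natAbs := by
  rw [encInt, if_neg (by omega)]
  rfl

theorem encInt_of_neg {z : ℤ} (hz : z < 0) : encInt z = .minus :: encNat z.natAbs := by
  rw [encInt, if_pos hz]
  rfl

theorem encInt_natCast (k : ℕ) : encInt k = encNat k := encInt_of_nonneg (Int.natCast_nonneg k)

theorem HasNum.bit_iff {s : List Letter} {t : ℕ} {z : ℤ} (h : HasNum s t z) (j : ℕ) :
    NumBit s t j ↔ z.natAbs.testBit j = true := by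
  obtain ⟨A, B, hs, ht, hA⟩ := h
  rw [← encodeNat_getElem?]
  rcases lt_or_ge z 0 with hz | hz
  · rw [encInt_of_neg hz, encNat] at hs
    -- The minus sign joins the prefix: it is not a digit, so the digits still start right behind
    -- the prefix.
    refine numBit_iff (A := A ++ [.minus]) (B := B) (by simp [hs]) ?_ (by simp) j
    rw [List.count_append, ht]
    simp
  · rw [encInt_of_nonneg hz, encNat] at hs
    exact numBit_iff (B := B) (by simp [hs]) ht hA.getLast?_ne_bit j

theorem HasNum.neg_iff {s : List Letter} {t : ℕ} {z : ℤ} (h : HasNum s t z) :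
    NumNeg s t ↔ z < 0 := by
  obtain ⟨A, B, hs, ht, hA⟩ := h
  unfold NumNeg
  rcases lt_or_ge z 0 with hz | hz
  · rw [encInt_of_neg hz, encNat] at hs
    rw [numStart_eq (A := A ++ [.minus]) (B := B) (d := Computability.encodeNat z.natAbs)
      (by simp [hs]) (by rw [List.count_append, ht]; simp) (by simp)]
    simp [hs, hz]
  · rw [encInt_of_nonneg hz, encNat] at hs
    rw [numStart_eq (B := B) (d := Computability.encodeNat z.natAbs) (by simp [hs]) ht
      hA.getLast?_ne_bit]
    refine iff_of_false (fun h => ?_) (not_lt.2 hz)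
    obtain ⟨h₁, h₂⟩ := h
    rw [hs, List.getElem?_append_left (by omega), ← List.getLast?_eq_getElem?] at h₂
    simpa using hA _ h₂

/-- Every digit one is a letter of `s`, so `s.length` digits suffice in all comparisons. -/
theorem HasNum.lt_two_pow {s : List Letter} {t : ℕ} {z : ℤ} (h : HasNum s t z) :
    z.natAbs < 2 ^ s.length := by
  refine Nat.lt_pow_two_of_testBit _ fun j hj => ?_
  rw [← Bool.not_eq_true, ← h.bit_iff]
  rintro ⟨-, h₂⟩
  rw [List.getElem?_eq_none (by omega)] at h₂
  simp at h₂

theorem HasNum.eq_iff {s : List Letter} {t u : ℕ} {z z' : ℤ} (h : HasNum s t z)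
    (h' : HasNum s u z') : NumEq s t u ↔ z.natAbs = z'.natAbs := by
  unfold NumEq
  simp only [h.bit_iff, h'.bit_iff]
  constructor
  · intro e
    refine Nat.eq_of_testBit_eq fun j => ?_
    rcases lt_or_ge j s.length with hj | hj
    · exact Bool.eq_iff_iff.2 (e j hj)
    · have hp := Nat.pow_le_pow_right (show 0 < 2 by norm_num) hj
      rw [Nat.testBit_lt_two_pow (h.lt_two_pow.trans_le hp),
        Nat.testBit_lt_two_pow (h'.lt_two_pow.trans_le hp)]
  · intro e j _
    rw [e]

/-- The index of a number is the count of end marks before it, so this count locates the numbers of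
block `i` in a concatenation of blocks. -/
theorem exists_flatMap_eq_append {β : Type} {g : β → List Letter} {c : ℕ}
    (hc : ∀ x, (g x).count .endNum = c) (hb : ∀ x, Boundary (g x)) (L : List β) {i : ℕ}
    (hi : i < L.length) :
    ∃ A B, L.flatMap g = A ++ (g L[i] ++ B) ∧ A.count .endNum = c * i ∧ Boundary A := by
  refine ⟨(L.take i).flatMap g, (L.drop (i + 1)).flatMap g, ?_, ?_, Boundary.flatMap hb _⟩
  · conv_lhs => rw [← List.take_append_drop i L, List.drop_eq_getElem_cons hi]
    rw [List.flatMap_append, List.flatMap_cons]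
  · rw [List.count_flatMap]
    have : List.map (List.count Letter.endNum ∘ g) (L.take i) = List.replicate i c := by
      rw [List.eq_replicate_iff]
      constructor
      · simp; omega
      · simp only [List.mem_map, Function.comp]
        rintro _ ⟨x, -, rfl⟩
        exact hc x
    rw [this, List.sum_replicate, smul_eq_mul, mul_comm]

theorem count_flatMap_const {β : Type} {g : β → List Letter} {l : Letter} {c : ℕ}
    (hc : ∀ x, (g x).count l = c) (L : List β) : (L.flatMap g).count l = c * L.length := by
  induction L with
  | nil => simp
  | cons x L ih => rw [List.flatMap_cons, List.count_append, hc, ih, List.length_cons]; ring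

theorem encNat_boundary (k : ℕ) : Boundary (encNat k) := boundary_concat_endNum _

theorem encNat_count_endNum (k : ℕ) : (encNat k).count .endNum = 1 := by
  rw [encNat, List.count_append, List.count_eq_zero_of_not_mem (by simp)]
  simp

theorem encNat_count_endBlock (k : ℕ) : (encNat k).count .endBlock = 0 := by
  simp [encNat, List.count_eq_zero_of_not_mem]

theorem encInt_boundary (z : ℤ) : Boundary (encInt z) := by
  rw [encInt, encNat, ← List.append_assoc]
  exact boundary_concat_endNum _

theorem encInt_count_endNum (z : ℤ) : (encInt z).count .endNum = 1 := by
  rw [encInt, List.count_append, encNat_count_endNum]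
  split_ifs <;> simp

theorem encInt_count_endBlock (z : ℤ) : (encInt z).count .endBlock = 0 := by
  rw [encInt, List.count_append, encNat_count_endBlock]
  split_ifs <;> simp

theorem encPreference_eq {m : ℕ} (p : Preference m) :
    encPreference p = (List.ofFn fun i => (p.symm i : ℕ)).flatMap encNat ++ [.endBlock] := by
  unfold encPreference
  congr 1
  -- The coercion of the candidates to numbers unfolds to a `flatMap` of singletons.
  change ((List.ofFn fun i => p.symm i).flatMap fun a : Fin m => [a.val]).flatMap encNat = _
  rw [← List.map_eq_flatMap, List.map_ofFn]
  rfl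

theorem encPreference_boundary {m : ℕ} (p : Preference m) : Boundary (encPreference p) :=
  boundary_concat_endBlock _

theorem encPreference_count_endNum {m : ℕ} (p : Preference m) :
    (encPreference p).count .endNum = m := by
  rw [encPreference_eq, List.count_append, count_flatMap_const encNat_count_endNum]
  simp

theorem encPreference_count_endBlock {m : ℕ} (p : Preference m) :
    (encPreference p).count .endBlock = 1 := by
  rw [encPreference_eq, List.count_append, count_flatMap_const encNat_count_endBlock]
  simp

theorem exists_encPreference_eq {m : ℕ} (p : Preference m) (i : Fin m) :
    ∃ A B, encPreference p = A ++ (encInt ((p.symm i : ℕ) : ℤ) ++ B) ∧ A.count .endNum = i ∧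
      Boundary A := by
  obtain ⟨A, B, h, hc, hb⟩ := exists_flatMap_eq_append encNat_count_endNum encNat_boundary
    (List.ofFn fun i => (p.symm i : ℕ)) (i := i) (by simp)
  refine ⟨A, B ++ [.endBlock], ?_, by simpa using hc, hb⟩
  rw [encPreference_eq, h, encInt_natCast]
  simp

theorem HasNum.of_append {s A C : List Letter} {t : ℕ} {z : ℤ} {B : List Letter}
    (h : ∃ A' B', C = A' ++ (encInt z ++ B') ∧ A'.count .endNum = t ∧ Boundary A')
    (hs : s = A ++ (C ++ B)) (hA : Boundary A) {t' : ℕ} (ht : A.count .endNum + t = t') :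
    HasNum s t' z := by
  obtain ⟨A', B', h₁, h₂, h₃⟩ := h
  refine ⟨A ++ A', B' ++ B, ?_, ?_, hA.append h₃⟩
  · rw [hs, h₁]
    simp
  · rw [List.count_append, h₂, ht]

/-! ### Reading an election. -/

/-- The numerator of the entry `i` of the scoring vector. -/
def scoreNum {m : ℕ} (α : Fin m → ℚ) (i : Fin m) : ℤ := (α i * commonDen α).num

/-- The data of the election `E` can be read off from the word `s`. -/
structure Reads (s : List Letter) (E : Election) : Prop where
  cand : candCount s = E.m
  score : ∀ i : Fin E.m, HasNum s (1 + i) (scoreNum E.α i)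
  tie : ∀ a : Fin E.m, HasNum s (1 + E.m + a) ((E.tie.symm a : ℕ) : ℤ)
  vote : ∀ (w : Fin E.n) (i : Fin E.m),
    HasNum s (1 + E.m + E.m * (w + 1) + i) (((E.profile w).symm i : ℕ) : ℤ)

/-- The scoring vector without the end mark. -/
def vectorBody {m : ℕ} (α : Fin m → ℚ) : List Letter :=
  encNat (commonDen α) ++ (List.ofFn (scoreNum α)).flatMap encInt

theorem encVector_eq {m : ℕ} (α : Fin m → ℚ) : encVector α = vectorBody α ++ [.endBlock] := rfl

theorem vectorBody_count_endNum {m : ℕ} (α : Fin m → ℚ) :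
    (vectorBody α).count .endNum = 1 + m := by
  rw [vectorBody, List.count_append, encNat_count_endNum,
    count_flatMap_const (c := 1) encInt_count_endNum]
  simp

theorem vectorBody_count_endBlock {m : ℕ} (α : Fin m → ℚ) :
    (vectorBody α).count .endBlock = 0 := by
  rw [vectorBody, List.count_append, encNat_count_endBlock,
    count_flatMap_const (c := 0) encInt_count_endBlock]
  simp

theorem encVector_count_endNum {m : ℕ} (α : Fin m → ℚ) : (encVector α).count .endNum = 1 + m := by
  rw [encVector_eq, List.count_append, vectorBody_count_endNum]
  simp

theorem votes_count_endNum {m n : ℕ} (P : Profile m n) :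
    ((List.ofFn P).flatMap encPreference).count .endNum = m * n := by
  rw [count_flatMap_const encPreference_count_endNum, List.length_ofFn]

theorem Election.encode_count_endNum (E : Election) :
    E.encode.count .endNum = 1 + E.m + E.m * (E.n + 1) := by
  unfold Election.encode
  rw [List.count_append, List.count_append, List.count_append, encVector_count_endNum,
    encPreference_count_endNum, votes_count_endNum]
  simp
  ring

/-- There is one mark per vote, and one each for the scoring vector, the tie-breaking order and the
whole election. -/
theorem Election.encode_count_endBlock (E : Election) : E.encode.count .endBlock = E.n + 3 := by
  unfold Election.encode
  rw [List.count_append, List.count_append, List.count_append, encVector_eq, List.count_append,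
    vectorBody_count_endBlock, encPreference_count_endBlock,
    count_flatMap_const encPreference_count_endBlock, List.length_ofFn]
  simp
  ring

theorem Election.encode_boundary (E : Election) : Boundary E.encode := boundary_concat_endBlock _

/-- In front of the first block mark stand the denominator and one score per position; hence the `1
+ m`. -/
theorem candCount_eq {s V B : List Letter} {m : ℕ} (hs : s = V ++ .endBlock :: B)
    (h₀ : V.count .endBlock = 0) (h₁ : V.count .endNum = 1 + m) : candCount s = m := by
  have hV : s.take V.length = V := by simp [hs]
  have e : ∑ i ∈ range s.length, ind (s[i]? = some .endNum ∧ occ s .endBlock i = 0) =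
      occ s .endNum V.length := by
    unfold occ
    rw [← Finset.sum_subset (Finset.range_subset_range.2
      (show V.length ≤ s.length by simp [hs]))]
    · refine Finset.sum_congr rfl fun i hi => ind_congr (and_iff_left ?_)
      have hi := Finset.mem_range.1 hi
      change occ s .endBlock i = 0
      rw [occ_eq_count, hs, List.take_append_of_le_length hi.le]
      exact Nat.eq_zero_of_le_zero (h₀ ▸ (List.take_sublist _ _).count_le _)
    · intro i hi hi'
      refine ind_of_not fun h => ?_
      obtain ⟨ha, hb⟩ := h
      change occ s .endBlock i = 0 at hb
      have hi' : V.length ≤ i := by simpa using hi'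
      rcases hi'.eq_or_lt with h | h
      · rw [hs, ← h] at ha
        simp at ha
      · rw [occ_eq_count] at hb
        have h₁ : (s.take (V.length + 1)).Sublist (s.take i) :=
          (List.take_prefix_take_left h).sublist
        have h₂ := h₁.count_le .endBlock
        rw [hs, List.take_append] at h₂
        rw [hs] at hb
        simp at h₂
        omega
  rw [candCount, e, occ_eq_count, hV, h₁]
  omega

/-- Numbers are counted from the front, so the rest `B` is arbitrary and one statement serves all
four problems. -/
theorem Election.reads_encode (E : Election) (B : List Letter) : Reads (E.encode ++ B) E where
  cand := by
    refine candCount_eq (V := vectorBody E.α) (B := encPreference E.tie ++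
      (List.ofFn E.profile).flatMap encPreference ++ [Letter.endBlock] ++ B) ?_
      (vectorBody_count_endBlock _) (vectorBody_count_endNum _)
    simp [Election.encode, encVector_eq]
  score i := by
    have h := exists_flatMap_eq_append encInt_count_endNum encInt_boundary
      (List.ofFn (scoreNum E.α)) (i := i) (by simp)
    rw [List.getElem_ofFn] at h
    refine HasNum.of_append (A := encNat (commonDen E.α)) (B := .endBlock :: encPreference E.tie ++
      (List.ofFn E.profile).flatMap encPreference ++ [Letter.endBlock] ++ B) h ?_
      (encNat_boundary _) ?_
    · simp [Election.encode, encVector_eq, vectorBody]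
    · rw [encNat_count_endNum, one_mul]
  tie a := by
    refine HasNum.of_append (A := encVector E.α) (B :=
      (List.ofFn E.profile).flatMap encPreference ++ [Letter.endBlock] ++ B)
      (exists_encPreference_eq E.tie a) ?_ (boundary_concat_endBlock _) ?_
    · simp [Election.encode]
    · rw [encVector_count_endNum]
  vote w i := by
    obtain ⟨A', B', h, hc, hb⟩ := exists_flatMap_eq_append encPreference_count_endNum
      encPreference_boundary (List.ofFn E.profile) (i := w) (by simp)
    rw [List.getElem_ofFn] at h
    refine HasNum.of_append (A := encVector E.α ++ encPreference E.tie ++ A')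
      (B := B' ++ [Letter.endBlock] ++ B)
      (exists_encPreference_eq (E.profile w) i) ?_
      (((boundary_concat_endBlock _).append (encPreference_boundary _)).append hb) ?_
    · simp [Election.encode, h]
    · rw [List.count_append, List.count_append, hc, encVector_count_endNum,
        encPreference_count_endNum]
      ring

end PossibleManipulators

namespace PossibleManipulators

open Function Finset

/-! ### Comparing sums digit by digit -/

/-- The invariant says that `u J - B`, as an integer, is the floor of the difference of the first
`J` columns' sums divided by `2 ^ J`, so its sign decides the comparison. The shift by `B` and the
bound on `R` keep the truncated subtraction exact. -/
theorem carry_lt_iff {B : ℕ} {L R u : ℕ → ℕ} (hR : ∀ j, R j ≤ B) (h0 : u 0 = B)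
    (hu : ∀ j, u (j + 1) = (u j + B + L j - R j) / 2) (J : ℕ) :
    u J < B ↔ ∑ j ∈ range J, L j * 2 ^ j < ∑ j ∈ range J, R j * 2 ^ j := by
  have key : ∀ J,
      u J * 2 ^ J + ∑ j ∈ range J, R j * 2 ^ j ≤ B * 2 ^ J + ∑ j ∈ range J, L j * 2 ^ j ∧
      B * 2 ^ J + ∑ j ∈ range J, L j * 2 ^ j < (u J + 1) * 2 ^ J + ∑ j ∈ range J, R j * 2 ^ j := by
    intro J
    induction J with
    | zero => simp [h0]
    | succ J ih =>
      rw [Finset.sum_range_succ, Finset.sum_range_succ, pow_succ]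
      have h₁ := hR J
      have h₂ : 2 * u (J + 1) + R J ≤ u J + B + L J := by have := hu J; omega
      have h₃ : u J + B + L J ≤ 2 * u (J + 1) + 1 + R J := by have := hu J; omega
      have h₄ := Nat.mul_le_mul_right (2 ^ J) h₂
      have h₅ := Nat.mul_le_mul_right (2 ^ J) h₃
      constructor <;> nlinarith [ih.1, ih.2]
  obtain ⟨h₁, h₂⟩ := key J
  constructor
  · intro h
    have := Nat.mul_le_mul_right (2 ^ J) (show u J + 1 ≤ B from h)
    omega
  · intro h
    by_contra h'
    have := Nat.mul_le_mul_right (2 ^ J) (not_lt.1 h')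
    omega

theorem sum_testBit {k J : ℕ} (hk : k < 2 ^ J) :
    ∑ j ∈ range J, ind (k.testBit j = true) * 2 ^ j = k := by
  have key : ∀ J, ∑ j ∈ range J, ind (k.testBit j = true) * 2 ^ j = k % 2 ^ J := by
    intro J
    induction J with
    | zero => simp [Nat.mod_one]
    | succ J ih =>
      rw [Finset.sum_range_succ, ih, Nat.mod_pow_succ, mul_comm (2 ^ J),
        Nat.testBit_eq_decide_div_mod_eq]
      congr 2
      rcases Nat.mod_two_eq_zero_or_one (k / 2 ^ J) with h | h <;> simp [ind, h]
  rw [key, Nat.mod_eq_of_lt hk]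

theorem HasNum.sum_pos {s : List Letter} {t : ℕ} {z : ℤ} (h : HasNum s t z) :
    ∑ j ∈ range s.length, ind (NumBit s t j ∧ ¬ NumNeg s t) * 2 ^ j = z.toNat := by
  rcases lt_or_ge z 0 with hz | hz
  · rw [Finset.sum_eq_zero fun j _ => ?_]
    · omega
    · rw [ind_of_not fun h' => h'.2 (h.neg_iff.2 hz), zero_mul]
  · rw [Finset.sum_congr rfl fun j _ => by
      rw [ind_congr ((and_iff_left (h.neg_iff.not.2 (not_lt.2 hz))).trans (h.bit_iff j))],
      sum_testBit h.lt_two_pow]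
    omega

theorem HasNum.sum_neg {s : List Letter} {t : ℕ} {z : ℤ} (h : HasNum s t z) :
    ∑ j ∈ range s.length, ind (NumBit s t j ∧ NumNeg s t) * 2 ^ j = (-z).toNat := by
  rcases lt_or_ge z 0 with hz | hz
  · rw [Finset.sum_congr rfl fun j _ => by
      rw [ind_congr ((and_iff_left (h.neg_iff.2 hz)).trans (h.bit_iff j))],
      sum_testBit h.lt_two_pow]
    omega
  · rw [Finset.sum_eq_zero fun j _ => ?_]
    · omega
    · rw [ind_of_not fun h' => not_lt.2 hz (h.neg_iff.1 h'.2), zero_mul]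

theorem sum_column {s : List Letter} {n v a i b p : ℕ} {za zb : Fin n → ℤ}
    (ha : ∀ w : Fin n, HasNum s (scoreIdx s v a i w) (za w))
    (hb : ∀ w : Fin n, HasNum s (scoreIdx s v b p w) (zb w)) :
    ∑ j ∈ range s.length, column s n v a i b p j * 2 ^ j =
      ∑ w, ((za w).toNat + (-zb w).toNat) := by
  unfold column
  simp only [Finset.sum_mul]
  rw [Finset.sum_comm, Finset.sum_range]
  refine Finset.sum_congr rfl fun w _ => ?_
  simp only [add_mul]
  rw [Finset.sum_add_distrib, (ha w).sum_pos, (hb w).sum_neg]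

/-- Each numerator is split into positive and negative part, and the negative parts change sides;
this leaves a comparison of sums of natural numbers. -/
theorem scoreLT_iff {s : List Letter} {n v a i b p : ℕ} {za zb : Fin n → ℤ}
    (ha : ∀ w : Fin n, HasNum s (scoreIdx s v a i w) (za w))
    (hb : ∀ w : Fin n, HasNum s (scoreIdx s v b p w) (zb w)) :
    ScoreLT s n v a i b p ↔ ∑ w, za w < ∑ w, zb w := by
  have h := carry_lt_iff (B := 2 * n) (L := column s n v a i b p) (R := column s n v b p a i)
    (u := carry s n v a i b p) (fun j => column_le _ _ _ _ _ _ _ _) rfl (fun j => rfl) s.length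
  unfold ScoreLT
  rw [h, sum_column ha hb, sum_column hb ha, ← Nat.cast_lt (α := ℤ)]
  have e : ∀ z z' : Fin n → ℤ, ((∑ w, ((z w).toNat + (-z' w).toNat) : ℕ) : ℤ) =
      ∑ w, ((z w).toNat : ℤ) + ∑ w, ((-z' w).toNat : ℤ) := by
    intro z z'
    push_cast
    rw [Finset.sum_add_distrib]
  have e' : ∀ z : Fin n → ℤ, ∑ w, z w = ∑ w, ((z w).toNat : ℤ) - ∑ w, ((-z w).toNat : ℤ) := by
    intro z
    rw [← Finset.sum_sub_distrib]
    exact Finset.sum_congr rfl fun w _ => by omega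
  rw [e, e, e' za, e' zb]
  omega

/-! ### Scores -/

/-- The denominator of each entry divides the common one, so the product is an integer and taking
its numerator loses nothing. -/
theorem scoreNum_cast {m : ℕ} (α : Fin m → ℚ) (i : Fin m) :
    (scoreNum α i : ℚ) = α i * commonDen α := by
  obtain ⟨k, hk⟩ : (α i).den ∣ commonDen α := Finset.dvd_lcm (Finset.mem_univ i)
  unfold scoreNum
  rw [hk]
  push_cast
  rw [← mul_assoc, Rat.mul_den_eq_num]
  have : ((α i).num * (k : ℚ) : ℚ) = (((α i).num * k : ℤ) : ℚ) := by push_cast; rfl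
  rw [this, Rat.num_intCast]

theorem commonDen_pos {m : ℕ} (α : Fin m → ℚ) : 0 < commonDen α := by
  refine Nat.pos_of_ne_zero fun h => ?_
  obtain ⟨i, -, hi⟩ := Finset.lcm_eq_zero_iff.1 h
  exact (α i).den_nz hi

/-- The sum of the numerators of the scores of the candidate `c`. -/
def intScore {m n : ℕ} (α : Fin m → ℚ) (P : Profile m n) (c : Fin m) : ℤ :=
  ∑ v, scoreNum α (P v c)

theorem intScore_cast {m n : ℕ} (α : Fin m → ℚ) (P : Profile m n) (c : Fin m) :
    (intScore α P c : ℚ) = score α P c * commonDen α := by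
  unfold intScore score
  push_cast
  rw [Finset.sum_mul]
  exact Finset.sum_congr rfl fun v _ => scoreNum_cast α _

theorem intScore_lt_iff {m n : ℕ} (α : Fin m → ℚ) (P : Profile m n) (c d : Fin m) :
    intScore α P c < intScore α P d ↔ score α P c < score α P d := by
  rw [← Int.cast_lt (R := ℚ), intScore_cast, intScore_cast]
  exact mul_lt_mul_iff_left₀ (by exact_mod_cast commonDen_pos α)

theorem intScore_le_iff {m n : ℕ} (α : Fin m → ℚ) (P : Profile m n) (c d : Fin m) :
    intScore α P c ≤ intScore α P d ↔ score α P c ≤ score α P d := by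
  rw [← not_lt, intScore_lt_iff, not_lt]

theorem scoreNum_antitone {m : ℕ} {α : Fin m → ℚ} (h : Antitone α) : Antitone (scoreNum α) := by
  intro i j hij
  rw [← Int.cast_le (R := ℚ), scoreNum_cast, scoreNum_cast]
  exact mul_le_mul_of_nonneg_right (h hij) (Nat.cast_nonneg _)

/-- With candidates named by their tie-breaking positions, a winner must strictly beat the earlier
names and at least tie with the later ones. -/
theorem scoringRule_eq_iff {m n : ℕ} (hm : 0 < m) (α : Fin m → ℚ) (t : Preference m)
    (P : Profile m n) (y : Fin m) :
    scoringRule hm α t n P = t.symm y ↔ ∀ a, a ≠ y →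
      (a < y → intScore α P (t.symm a) < intScore α P (t.symm y)) ∧
      (y ≤ a → intScore α P (t.symm a) ≤ intScore α P (t.symm y)) := by
  simp only [intScore_lt_iff, intScore_le_iff]
  unfold scoringRule tieBreak
  rw [t.symm.injective.eq_iff]
  have hmem : ∀ a, a ∈ (coWinners α P).image t ↔ ∀ d, score α P d ≤ score α P (t.symm a) := by
    intro a
    simp only [coWinners, Finset.mem_image, Finset.mem_filter, Finset.mem_univ, true_and]
    constructor
    · rintro ⟨c, hc, rfl⟩
      simpa using hc
    · exact fun h => ⟨t.symm a, h, by simp⟩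
  constructor
  · intro h a ha
    have hy : y ∈ (coWinners α P).image t := h ▸ Finset.min'_mem _ _
    rw [hmem] at hy
    refine ⟨fun hay => (hy _).lt_of_ne fun e => ?_, fun _ => hy _⟩
    have ha' : a ∈ (coWinners α P).image t := (hmem a).2 fun d => e ▸ hy d
    exact absurd (h ▸ Finset.min'_le _ a ha') (not_le.2 hay)
  · intro h
    refine (Finset.min'_eq_iff _ _ _).2 ⟨(hmem y).2 fun d => ?_, fun a ha => ?_⟩
    · by_cases hd : t d = y
      · rw [← hd]; simp
      · have := h (t d) hd
        rw [Equiv.symm_apply_apply] at this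
        rcases lt_or_ge (t d) y with h' | h'
        · exact (this.1 h').le
        · exact this.2 h'
    · by_contra hay
      have hay := not_le.1 hay
      exact absurd ((hmem a).1 ha (t.symm y)) (not_le.2 ((h a hay.ne).1 hay))

/-! ### Placing the candidates -/

theorem card_filter_eq_sum_ind {β : Type} [Fintype β] (P : β → Prop) [DecidablePred P] :
    (Finset.univ.filter P).card = ∑ c, ind (P c) := by
  rw [Finset.card_filter]
  refine Finset.sum_congr rfl fun c _ => ?_
  unfold ind
  split_ifs <;> rfl

/-- There is an order that has `x` at position `q` and `y` at position `p` and that places every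
other candidate at an admissible position, provided enough candidates are admissible at each
position; later positions are admissible for more candidates. -/
theorem exists_preference_iff {m : ℕ} {x y p q : Fin m} (hxy : x ≠ y) (hpq : p ≠ q)
    {ok : Fin m → Fin m → Prop} (hok : ∀ c i j, i ≤ j → ok c i → ok c j) :
    (∃ Q : Preference m, Q x = q ∧ Q y = p ∧ ∀ c, c ≠ x → c ≠ y → ok c (Q c)) ↔
      ∀ i : Fin m, (i : ℕ) + 1 ≤ ∑ c, ind (c ≠ x ∧ c ≠ y ∧ ok c i) + ind (p ≤ i) + ind (q ≤ i) := by
  classical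
  simp only [← card_filter_eq_sum_ind]
  constructor
  · rintro ⟨Q, hx, hy, hQ⟩ i
    -- Necessity: each of the `i + 1` candidates placed no lower than `i` is `x`, `y` or, by
    -- monotonicity, admissible at `i`.
    have hsub : (Finset.Iic i).map Q.symm.toEmbedding ⊆
        Finset.univ.filter (fun c => c ≠ x ∧ c ≠ y ∧ ok c i) ∪
          (if p ≤ i then {y} else ∅) ∪ (if q ≤ i then {x} else ∅) := by
      intro c hc
      obtain ⟨j, hj, rfl⟩ := Finset.mem_map.1 hc
      have hj := Finset.mem_Iic.1 hj
      simp only [Equiv.coe_toEmbedding, Finset.mem_union, Finset.mem_filter, Finset.mem_univ,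
        true_and]
      by_cases h₁ : Q.symm j = x
      · right
        have : j = q := by rw [← hx, ← h₁]; simp
        rw [if_pos (this ▸ hj), h₁]
        simp
      by_cases h₂ : Q.symm j = y
      · left; right
        have : j = p := by rw [← hy, ← h₂]; simp
        rw [if_pos (this ▸ hj), h₂]
        simp
      · left; left
        refine ⟨h₁, h₂, hok _ _ _ hj ?_⟩
        have := hQ _ h₁ h₂
        rwa [Equiv.apply_symm_apply] at this
    have h := Finset.card_le_card hsub
    rw [Finset.card_map, Fin.card_Iic] at h
    refine h.trans ((Finset.card_union_le _ _).trans (add_le_add ((Finset.card_union_le _ _).trans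
      (add_le_add le_rfl ?_)) ?_))
    all_goals
      unfold ind
      split_ifs <;> simp
  · intro h
    let T : {i : Fin m // i ≠ p ∧ i ≠ q} → Finset (Fin m) := fun i =>
      Finset.univ.filter fun c => c ≠ x ∧ c ≠ y ∧ ok c i
    have hall : ∀ S : Finset {i : Fin m // i ≠ p ∧ i ≠ q}, S.card ≤ (S.biUnion T).card := by
      intro S
      rcases S.eq_empty_or_nonempty with rfl | hS
      · simp
      -- The sets `T i` are nested, so Hall's condition for `S` only needs `T` at the lowest-ranked
      -- position in `S`. Together with those of `p` and `q` that are at most `i`, the members of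
      -- `S` lie among `i + 1` positions.
      obtain ⟨i, hi, hmax⟩ := S.exists_max_image (fun i => (i : Fin m)) hS
      refine le_trans ?_ (Finset.card_le_card (Finset.subset_biUnion_of_mem T hi))
      have hdisj : Disjoint (S.map (Function.Embedding.subtype _))
          (({p, q} : Finset (Fin m)).filter (· ≤ (i : Fin m))) := by
        rw [Finset.disjoint_left]
        intro j hj hj'
        obtain ⟨k, -, rfl⟩ := Finset.mem_map.1 hj
        have := (Finset.mem_filter.1 hj').1
        simp only [Function.Embedding.coe_subtype, Finset.mem_insert, Finset.mem_singleton] at this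
        exact this.elim k.2.1 k.2.2
      have hsub : (S.map (Function.Embedding.subtype _)).disjUnion
          (({p, q} : Finset (Fin m)).filter (· ≤ (i : Fin m))) hdisj ⊆ Finset.Iic (i : Fin m) := by
        intro j hj
        rw [Finset.mem_Iic]
        rcases Finset.mem_disjUnion.1 hj with hj | hj
        · obtain ⟨k, hk, rfl⟩ := Finset.mem_map.1 hj
          exact hmax k hk
        · exact (Finset.mem_filter.1 hj).2
      have h₁ := Finset.card_le_card hsub
      rw [Finset.card_disjUnion, Finset.card_map, Fin.card_Iic] at h₁
      have h₂ : (({p, q} : Finset (Fin m)).filter (· ≤ (i : Fin m))).card =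
          ind (p ≤ (i : Fin m)) + ind (q ≤ (i : Fin m)) := by
        rw [Finset.card_filter, Finset.sum_pair hpq]
        unfold ind
        split_ifs <;> rfl
      have h₃ := h i
      have h₄ : (T i).card = (Finset.univ.filter fun c => c ≠ x ∧ c ≠ y ∧ ok c i).card := rfl
      omega
    obtain ⟨f, hf, hfT⟩ := (Finset.all_card_le_biUnion_card_iff_exists_injective T).1 hall
    have hfT' : ∀ i, f i ≠ x ∧ f i ≠ y ∧ ok (f i) i := fun i => by
      simpa [T] using hfT i
    let g : Fin m → Fin m := fun i =>
      if hp : i = p then y else if hq : i = q then x else f ⟨i, hp, hq⟩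
    have hgp : g p = y := dif_pos rfl
    have hgq : g q = x := (dif_neg hpq.symm).trans (dif_pos rfl)
    have hgf : ∀ i (hp : i ≠ p) (hq : i ≠ q), g i = f ⟨i, hp, hq⟩ := fun i hp hq =>
      (dif_neg hp).trans (dif_neg hq)
    have hg : Function.Injective g := by
      intro i j hij
      by_cases hip : i = p
      · by_cases hjp : j = p
        · rw [hip, hjp]
        by_cases hjq : j = q
        · rw [hip, hjq, hgp, hgq] at hij
          exact absurd hij.symm hxy
        · rw [hip, hgp, hgf j hjp hjq] at hij
          exact absurd hij.symm (hfT' _).2.1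
      by_cases hiq : i = q
      · by_cases hjp : j = p
        · rw [hiq, hjp, hgp, hgq] at hij
          exact absurd hij hxy
        by_cases hjq : j = q
        · rw [hiq, hjq]
        · rw [hiq, hgq, hgf j hjp hjq] at hij
          exact absurd hij.symm (hfT' _).1
      · rw [hgf i hip hiq] at hij
        by_cases hjp : j = p
        · rw [hjp, hgp] at hij
          exact absurd hij (hfT' _).2.1
        by_cases hjq : j = q
        · rw [hjq, hgq] at hij
          exact absurd hij (hfT' _).1
        · rw [hgf j hjp hjq] at hij
          exact congrArg Subtype.val (hf hij)
    let e : Preference m := Equiv.ofBijective g (Finite.injective_iff_bijective.1 hg)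
    have he : ∀ i, e i = g i := fun i => rfl
    -- The matching sends positions to candidates; a preference is its inverse.
    refine ⟨e.symm, ?_, ?_, fun c hcx hcy => ?_⟩
    · rw [Equiv.symm_apply_eq, he, hgq]
    · rw [Equiv.symm_apply_eq, he, hgp]
    · have hc : g (e.symm c) = c := by rw [← he, Equiv.apply_symm_apply]
      have hp : e.symm c ≠ p := fun h' => hcy (by rw [← hc, h', hgp])
      have hq : e.symm c ≠ q := fun h' => hcx (by rw [← hc, h', hgq])
      rw [hgf _ hp hq] at hc
      have := (hfT' ⟨e.symm c, hp, hq⟩).2.2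
      rwa [hc] at this

end PossibleManipulators

namespace PossibleManipulators

open Function Finset

/-! ### Correctness of the decision procedure -/

section

variable {s : List Letter} {E : Election}

/-- Exactly one position of the vote carries the name of `a`, and the weighted sum picks it out. -/
theorem Reads.votePos_eq (R : Reads s E) (w : Fin E.n) (a : Fin E.m) :
    votePos s w a = E.profile w (E.tie.symm a) := by
  unfold votePos voteIdx candIdx
  rw [R.cand, Finset.sum_range]
  have h : ∀ i : Fin E.m, NumEq s (1 + E.m + E.m * (w + 1) + i) (1 + E.m + a) ↔
      i = E.profile w (E.tie.symm a) := by
    intro i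
    rw [(R.vote w i).eq_iff (R.tie a), Int.natAbs_natCast, Int.natAbs_natCast, Fin.val_inj,
      Equiv.symm_apply_eq]
  rw [Finset.sum_eq_single (E.profile w (E.tie.symm a))]
  · rw [ind_of ((h _).2 rfl), mul_one]
  · intro i _ hi
    rw [ind_of_not fun h' => hi ((h i).1 h'), mul_zero]
  · simp

/-- The sum of the numerators of the scores of the candidate `a`, if the vote `v` places it at
position `i`. -/
def movedScore (E : Election) (v : ℕ) (a i : Fin E.m) : ℤ :=
  ∑ w : Fin E.n, scoreNum E.α (if (w : ℕ) = v then i else E.profile w (E.tie.symm a))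

theorem Reads.hasNum_scoreIdx (R : Reads s E) (v : ℕ) (a i : Fin E.m) (w : Fin E.n) :
    HasNum s (scoreIdx s v a i w)
      (scoreNum E.α (if (w : ℕ) = v then i else E.profile w (E.tie.symm a))) := by
  unfold scoreIdx
  split_ifs with h
  · exact R.score i
  · rw [R.votePos_eq]
    exact R.score _

theorem Reads.ahead_iff (R : Reads s E) (v : ℕ) (b p a i : Fin E.m) :
    Ahead s E.n v b p a i ↔ (a < b → movedScore E v a i < movedScore E v b p) ∧
      (b ≤ a → movedScore E v a i ≤ movedScore E v b p) := by
  unfold Ahead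
  rw [scoreLT_iff (R.hasNum_scoreIdx v a i) (R.hasNum_scoreIdx v b p),
    scoreLT_iff (R.hasNum_scoreIdx v b p) (R.hasNum_scoreIdx v a i), not_lt]
  rfl

/-- An index `v` from `E.n` on names no voter. So `Wins`, with `v = n`, refers to the reported
votes, and the positions passed to it are dummies. -/
theorem movedScore_of_le {v : ℕ} (hv : E.n ≤ v) (a i : Fin E.m) :
    movedScore E v a i = intScore E.α E.profile (E.tie.symm a) :=
  Finset.sum_congr rfl fun w _ => by rw [if_neg (by omega)]

/-- A changed vote affects the score of a candidate only through that candidate's own position, so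
candidates can be tested one at a time. -/
theorem movedScore_update (v : Fin E.n) (Q : Preference E.m) (a : Fin E.m) :
    movedScore E v a (Q (E.tie.symm a)) =
      intScore E.α (update E.profile v Q) (E.tie.symm a) :=
  Finset.sum_congr rfl fun w _ => by
    rw [update_apply]
    by_cases h : w = v
    · rw [if_pos h, if_pos (congrArg _ h)]
    · rw [if_neg h, if_neg (fun h' => h (Fin.ext h'))]

/-- This supplies the monotonicity that `exists_preference_iff` demands. -/
theorem movedScore_antitone (v : ℕ) (a : Fin E.m) : Antitone (movedScore E v a) := by
  intro i j hij
  refine Finset.sum_le_sum fun w _ => ?_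
  split_ifs
  · exact scoreNum_antitone E.α_antitone hij
  · exact le_rfl

theorem Reads.wins_iff (R : Reads s E) (x : Fin E.m) :
    Wins s E.n x ↔ E.rule E.profile = E.tie.symm x := by
  unfold Wins Election.rule
  rw [scoringRule_eq_iff, R.cand]
  have h := fun c : Fin E.m => R.ahead_iff E.n x ⟨0, E.m_pos⟩ c ⟨0, E.m_pos⟩
  simp only [movedScore_of_le le_rfl] at h
  constructor
  · exact fun H a ha => (h a).1 (H a a.2 fun e => ha (Fin.ext e))
  · exact fun H c hc hcx => (h ⟨c, hc⟩).2 (H ⟨c, hc⟩ fun e => hcx (congrArg Fin.val e))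

/-- The vote `v` can be changed to an order with `x` at position `q` and `y` at position `p` such
that `y` wins. -/
theorem Reads.placeable_iff (R : Reads s E) (v : Fin E.n) {x y p q : Fin E.m} (hxy : x ≠ y)
    (hqp : q < p) :
    Ahead s E.n v y p x q ∧ Placeable s E.n v x y p q ↔
      ∃ Q : Preference E.m, Q (E.tie.symm x) = q ∧ Q (E.tie.symm y) = p ∧
        E.rule (update E.profile v Q) = E.tie.symm y := by
  have h₁ : Placeable s E.n v x y p q ↔ ∀ i : Fin E.m, (i : ℕ) + 1 ≤
      ∑ c : Fin E.m, ind (c ≠ x ∧ c ≠ y ∧ Ahead s E.n v y p c i) + ind (p ≤ i) + ind (q ≤ i) := by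
    unfold Placeable
    rw [R.cand]
    constructor
    · intro h i
      have := h i i.2
      rw [Finset.sum_range] at this
      simpa [Fin.ext_iff] using this
    · intro h i hi
      have := h ⟨i, hi⟩
      rw [Finset.sum_range]
      simpa [Fin.ext_iff, Fin.le_def] using this
  have h₂ := exists_preference_iff hxy hqp.ne' (ok := fun c i => Ahead s E.n v y p c i) (by
    intro c i j hij
    rw [R.ahead_iff, R.ahead_iff]
    have := movedScore_antitone v c hij
    exact fun h => ⟨fun h' => this.trans_lt (h.1 h'), fun h' => this.trans (h.2 h')⟩)
  rw [h₁, ← h₂]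
  -- Here `Q` ranks tie-breaking positions; `E.tie.trans Q` is the corresponding vote on the
  -- candidates themselves.
  have h₃ : ∀ Q : Preference E.m, Q y = p → ((∀ c, c ≠ y → Ahead s E.n v y p c (Q c)) ↔
      E.rule (update E.profile v (E.tie.trans Q)) = E.tie.symm y) := by
    intro Q hy
    unfold Election.rule
    rw [scoringRule_eq_iff]
    refine forall_congr' fun c => imp_congr_right fun _ => ?_
    have e : ∀ c, Q c = (E.tie.trans Q) (E.tie.symm c) := fun c => by simp
    rw [R.ahead_iff, ← hy, e, e, movedScore_update, movedScore_update]
  constructor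
  · rintro ⟨hx, Q, hqx, hpy, hQ⟩
    refine ⟨E.tie.trans Q, by simpa using hqx, by simpa using hpy, (h₃ Q hpy).1 fun c hc => ?_⟩
    by_cases hcx : c = x
    · rw [hcx, hqx]; exact hx
    · exact hQ c hcx hc
  · rintro ⟨Q, hqx, hpy, hr⟩
    have hr' := (h₃ (E.tie.symm.trans Q) (by simpa using hpy)).2 (by
      rwa [← Equiv.trans_assoc, Equiv.self_trans_symm, Equiv.refl_trans])
    refine ⟨?_, E.tie.symm.trans Q, by simpa using hqx, by simpa using hpy,
      fun c _ hc => hr' c hc⟩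
    have := hr' x hxy
    rwa [Equiv.trans_apply, hqx] at this

/-! ### Coalitions of at most one voter. -/

theorem replaceVotes_singleton {m n : ℕ} (P : Profile m n) (v : Fin n)
    (Q : ({v} : Finset (Fin n)) → Preference m) :
    replaceVotes P {v} Q = update P v (Q ⟨v, Finset.mem_singleton_self v⟩) := by
  funext w
  unfold replaceVotes
  by_cases h : w = v
  · subst h
    rw [dif_pos (Finset.mem_singleton_self w), update_self]
  · rw [dif_neg (by simpa using h), update_of_ne h]

/-- The required preference is weak, but `y` differs from the winner and votes are injective, so it
is strict. -/
theorem isCoalitionAgainst_singleton {m n : ℕ} (r : VotingRule m n) (P : Profile m n) (v : Fin n)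
    (y : Fin m) : IsCoalitionAgainst r P {v} y ↔
      y ≠ r P ∧ ∃ Q : Preference m, Q (r P) < Q y ∧ r (update P v Q) = y := by
  unfold IsCoalitionAgainst
  refine and_congr_right fun hy => ?_
  constructor
  · rintro ⟨Q, hQ, hr⟩
    rw [replaceVotes_singleton] at hr
    refine ⟨_, lt_of_le_of_ne (hQ ⟨v, Finset.mem_singleton_self v⟩) fun e => ?_, hr⟩
    exact hy (Equiv.injective _ e).symm
  · rintro ⟨Q, hQ, hr⟩
    refine ⟨fun _ => Q, fun _ => hQ.le, ?_⟩
    rw [replaceVotes_singleton]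
    exact hr

/-- With no vote replaced the winner stays the same, so it cannot become `y`. -/
theorem not_isCoalitionAgainst_empty {m n : ℕ} (r : VotingRule m n) (P : Profile m n)
    (y : Fin m) : ¬ IsCoalitionAgainst r P ∅ y := by
  rintro ⟨hy, Q, -, hr⟩
  refine hy (hr.symm.trans (congrArg r ?_))
  funext v
  exact dif_neg (Finset.notMem_empty v)

/-- The bound `x` can only be the name of the current winner, and `q`, `p` are the positions of `x`
and `y` in the manipulated vote. -/
theorem Reads.suspect_iff (R : Reads s E) (v : Fin E.n) (y : Fin E.m) :
    Suspect s E.n v y ↔ IsCoalitionAgainst E.rule E.profile {v} (E.tie.symm y) := by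
  rw [isCoalitionAgainst_singleton]
  unfold Suspect
  rw [R.cand]
  constructor
  · rintro ⟨x, hx, hw, hxy, p, hp, q, hq, h⟩
    have hw := (R.wins_iff ⟨x, hx⟩).1 hw
    obtain ⟨Q, hQx, hQy, hr⟩ := (R.placeable_iff v (x := ⟨x, hx⟩) (y := y) (p := ⟨p, hp⟩)
      (q := ⟨q, hq.trans hp⟩) (fun e => hxy (congrArg Fin.val e)) hq).1 h
    refine ⟨?_, Q, ?_, hr⟩
    · rw [hw, Ne, E.tie.symm.injective.eq_iff]
      exact fun e => hxy (congrArg Fin.val e).symm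
    · rw [hw, hQx, hQy]
      exact hq
  · rintro ⟨hy, Q, hQ, hr⟩
    have hw : E.rule E.profile = E.tie.symm (E.tie (E.rule E.profile)) := by simp
    have hxy : E.tie (E.rule E.profile) ≠ y := fun e => hy (by rw [← e]; simp)
    obtain ⟨h₁, h₂⟩ := (R.placeable_iff v hxy hQ).2 ⟨Q, by simp, rfl, hr⟩
    exact ⟨E.tie (E.rule E.profile), Fin.is_lt _, (R.wins_iff _).2 hw,
      fun e => hxy (Fin.ext e), _, Fin.is_lt _, _, hQ, h₁, h₂⟩

theorem Reads.isGiven_iff (R : Reads s E) {y : Fin E.m}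
    (hy : HasNum s (1 + E.m + E.m * (E.n + 1)) ((y : ℕ) : ℤ)) (a : Fin E.m) :
    IsGiven s E.n a ↔ E.tie.symm a = y := by
  unfold IsGiven candIdx
  rw [R.cand, (R.tie a).eq_iff hy, Int.natAbs_natCast, Int.natAbs_natCast, Fin.val_inj]

theorem Reads.exists_suspect_iff (R : Reads s E) (v : Fin E.n) :
    (∃ y < candCount s, Suspect s E.n v y) ↔ IsCoalition E.rule E.profile {v} := by
  rw [R.cand]
  constructor
  · rintro ⟨y, hy, h⟩
    exact ⟨_, (R.suspect_iff v ⟨y, hy⟩).1 h⟩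
  · rintro ⟨y, h⟩
    refine ⟨E.tie y, Fin.is_lt _, (R.suspect_iff v _).2 ?_⟩
    rwa [Equiv.symm_apply_apply]

theorem Reads.exists_given_suspect_iff (R : Reads s E) {y : Fin E.m}
    (hy : HasNum s (1 + E.m + E.m * (E.n + 1)) ((y : ℕ) : ℤ)) (v : Fin E.n) :
    (∃ a < candCount s, IsGiven s E.n a ∧ Suspect s E.n v a) ↔
      IsCoalitionAgainst E.rule E.profile {v} y := by
  rw [R.cand]
  constructor
  · rintro ⟨a, ha, h₁, h₂⟩
    rw [← (R.isGiven_iff hy ⟨a, ha⟩).1 h₁]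
    exact (R.suspect_iff v ⟨a, ha⟩).1 h₂
  · intro h
    refine ⟨E.tie y, Fin.is_lt _, (R.isGiven_iff hy _).2 (by simp), (R.suspect_iff v _).2 ?_⟩
    rwa [Equiv.symm_apply_apply]

end

/-! ### Correctness for the four problems. -/

theorem voterCount_eq {E : Election} {B : List Letter} {k : ℕ} (h : B.count .endBlock + 3 = k) :
    voterCount k (E.encode ++ B) = E.n := by
  unfold voterCount
  rw [occ_eq_count, List.take_length, List.count_append, E.encode_count_endBlock]
  omega

/-- The block mark with index `n + 2` is the last letter of the election, so the characteristic
vector starts right behind it. -/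
theorem member_iff {E : Election} (M : Finset (Fin E.n)) (B : List Letter) (v : Fin E.n) :
    Member (E.encode ++ (encVoters M ++ B)) E.n v ↔ v ∈ M := by
  obtain ⟨A, hA⟩ : ∃ A, E.encode = A ++ [.endBlock] := ⟨_, rfl⟩
  have hc : A.count .endBlock = E.n + 2 := by
    have := E.encode_count_endBlock
    rw [hA, List.count_append, List.count_singleton_self] at this
    omega
  unfold Member
  rw [occPos_eq (P := A) (B := encVoters M ++ B) (by simp [hA]) hc, hA,
    List.getElem?_append_right (by simp)]
  have e : A.length + 1 + v - (A ++ [Letter.endBlock]).length = v := by simp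
  rw [e, encVoters, List.append_assoc, List.getElem?_append_left (by simp)]
  simp

/-- Between the election and the given candidate there may be a coalition; it contains no number, so
the index is the same in both problems. -/
theorem hasNum_given (E : Election) {C B : List Letter} (hC : Boundary C)
    (hc : C.count .endNum = 0) (k : ℕ) :
    HasNum (E.encode ++ (C ++ (encNat k ++ B))) (1 + E.m + E.m * (E.n + 1)) (k : ℤ) := by
  refine ⟨E.encode ++ C, B, by rw [encInt_natCast]; simp, ?_, E.encode_boundary.append hC⟩
  rw [List.count_append, E.encode_count_endNum, hc, add_zero]

theorem encVoters_count_endNum {n : ℕ} (M : Finset (Fin n)) : (encVoters M).count .endNum = 0 :=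
  List.count_eq_zero_of_not_mem (by simp [encVoters])

theorem encVoters_count_endBlock {n : ℕ} (M : Finset (Fin n)) :
    (encVoters M).count .endBlock = 1 := by
  rw [encVoters, List.count_append, List.count_eq_zero_of_not_mem (by simp)]
  simp

theorem CPMW.decide_iff (I : CPMW) (hI : I.M.card = 1) : DecideCPMW I.encode ↔ I.IsYes := by
  obtain ⟨u, hu⟩ := Finset.card_eq_one.1 hI
  have hs : I.encode = I.toElection.encode ++ (encVoters I.M ++ (encNat I.y ++ [])) := by
    simp [CPMW.encode]
  have R := I.toElection.reads_encode (encVoters I.M ++ (encNat I.y ++ []))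
  have hn : voterCount 4 I.encode = I.n := by
    rw [hs]
    refine voterCount_eq ?_
    simp [encVoters_count_endBlock, encNat_count_endBlock]
  have hy := hasNum_given I.toElection (C := encVoters I.M) (B := [])
    (boundary_concat_endBlock _) (encVoters_count_endNum _) I.y
  unfold DecideCPMW CPMW.IsYes
  rw [hn, hs]
  constructor
  · rintro ⟨v, hv, hm, h⟩
    have hm := (member_iff I.M _ ⟨v, hv⟩).1 hm
    rw [hu, Finset.mem_singleton] at hm
    rw [hu, ← hm]
    exact (R.exists_given_suspect_iff hy ⟨v, hv⟩).1 h
  · intro h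
    rw [hu] at h
    exact ⟨u, u.2, (member_iff I.M _ u).2 (by rw [hu]; exact Finset.mem_singleton_self u),
      (R.exists_given_suspect_iff hy u).2 h⟩

theorem CPM.decide_iff (I : CPM) (hI : I.M.card = 1) : DecideCPM I.encode ↔ I.IsYes := by
  obtain ⟨u, hu⟩ := Finset.card_eq_one.1 hI
  have hs : I.encode = I.toElection.encode ++ (encVoters I.M ++ []) := by
    simp [CPM.encode]
  have R := I.toElection.reads_encode (encVoters I.M ++ [])
  have hn : voterCount 4 I.encode = I.n := by
    rw [hs]
    refine voterCount_eq ?_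
    simp [encVoters_count_endBlock]
  unfold DecideCPM CPM.IsYes
  rw [hn, hs]
  constructor
  · rintro ⟨v, hv, hm, h⟩
    have hm := (member_iff I.M _ ⟨v, hv⟩).1 hm
    rw [hu, Finset.mem_singleton] at hm
    rw [hu, ← hm]
    exact (R.exists_suspect_iff ⟨v, hv⟩).1 h
  · intro h
    rw [hu] at h
    exact ⟨u, u.2, (member_iff I.M _ u).2 (by rw [hu]; exact Finset.mem_singleton_self u),
      (R.exists_suspect_iff u).2 h⟩

theorem exists_card_le_one_iff {n : ℕ} {p : Finset (Fin n) → Prop} (h₀ : ¬ p ∅) :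
    (∃ M : Finset (Fin n), M.card ≤ 1 ∧ p M) ↔ ∃ v, p {v} := by
  constructor
  · rintro ⟨M, hM, h⟩
    rcases Nat.le_one_iff_eq_zero_or_eq_one.1 hM with h' | h'
    · exact absurd (Finset.card_eq_zero.1 h' ▸ h) h₀
    · obtain ⟨v, rfl⟩ := Finset.card_eq_one.1 h'
      exact ⟨v, h⟩
  · rintro ⟨v, h⟩
    exact ⟨{v}, by simp, h⟩

theorem CPMSW.decide_iff (I : CPMSW) (hI : I.k = 1) : DecideCPMSW I.encode ↔ I.IsYes := by
  have hs : I.encode = I.toElection.encode ++ ([] ++ (encNat I.y ++ encNat I.k)) := by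
    simp [CPMSW.encode]
  have R := I.toElection.reads_encode ([] ++ (encNat I.y ++ encNat I.k))
  have hn : voterCount 3 I.encode = I.n := by
    rw [hs]
    refine voterCount_eq ?_
    simp [encNat_count_endBlock]
  have hy := hasNum_given I.toElection (C := []) (B := encNat I.k) Boundary.nil rfl I.y
  unfold DecideCPMSW CPMSW.IsYes
  rw [hn, hs, hI, exists_card_le_one_iff (not_isCoalitionAgainst_empty _ _ _)]
  -- Rewriting the goal has replaced `I.k` inside the word too, and the facts about the word must
  -- follow.
  rw [hI] at R hy
  constructor
  · rintro ⟨v, hv, h⟩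
    exact ⟨⟨v, hv⟩, (R.exists_given_suspect_iff hy ⟨v, hv⟩).1 h⟩
  · rintro ⟨v, h⟩
    exact ⟨v, v.2, (R.exists_given_suspect_iff hy v).2 h⟩

theorem CPMS.decide_iff (I : CPMS) (hI : I.k = 1) : DecideCPMS I.encode ↔ I.IsYes := by
  have R := I.toElection.reads_encode (encNat I.k)
  have hn : voterCount 3 I.encode = I.n := voterCount_eq (by rw [encNat_count_endBlock])
  unfold DecideCPMS CPMS.IsYes
  rw [hn, hI, exists_card_le_one_iff fun ⟨y, hy⟩ => not_isCoalitionAgainst_empty _ _ y hy]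
  constructor
  · rintro ⟨v, hv, h⟩
    exact ⟨⟨v, hv⟩, (R.exists_suspect_iff ⟨v, hv⟩).1 h⟩
  · rintro ⟨v, h⟩
    exact ⟨v, v.2, (R.exists_suspect_iff v).2 h⟩

end PossibleManipulators

theorem mainTheorem1 :
    PossibleManipulators.InP
      (fun I : {I : PossibleManipulators.CPMW // I.M.card = 1} => I.1.encode)
      (fun I => I.1.IsYes) ∧
    PossibleManipulators.InP
      (fun I : {I : PossibleManipulators.CPM // I.M.card = 1} => I.1.encode)
      (fun I => I.1.IsYes) ∧
    PossibleManipulators.InP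
      (fun I : {I : PossibleManipulators.CPMSW // I.k = 1} => I.1.encode)
      (fun I => I.1.IsYes) ∧
    PossibleManipulators.InP
      (fun I : {I : PossibleManipulators.CPMS // I.k = 1} => I.1.encode)
      (fun I => I.1.IsYes) := by
  open PossibleManipulators in
  exact ⟨PTPred.decideCPMW.inP fun I => I.1.decide_iff I.2,
    PTPred.decideCPM.inP fun I => I.1.decide_iff I.2,
    PTPred.decideCPMSW.inP fun I => I.1.decide_iff I.2,
    PTPred.decideCPMS.inP fun I => I.1.decide_iff I.2⟩
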